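/- **Setting.** Fix a signature with countably many function symbols, a set of predicate symbols, and variables $x_0,x_1,\dots$. Substitutions act on the right; $\theta\gamma$ means "first $\theta$, then $\gamma$". A logic program $P$ is a finite set of clauses $A\leftarrow B_1,\dots,B_q$ ($q\ge 0$), the $B_j$ being distinct atoms. Let $At(n)$ be the set of atoms in the variables $x_0,\dots,x_{n-1}$. The program induces the lax natural coalgebra $p:At\to P_cP_fAt$ ($P_c$, $P_f$: countable, finite subsets), where $p(n)(A)$ is the set of all sets $\{B_1\tau,\dots,B_q\tau\}\subseteq At(n)$ with $C=(B\leftarrow B_1,\dots,B_q)\in P$ and $B\tau=A$. For $A\in At(n)$, $\bar p(A)$ is the locally injective labelled $\&\vee_c$-tree obtained by unfolding $p(n)$: the root is an and-node labelled $A$; an and-node labelled $A'$ has one or-child for each $s\in p(n)(A')$; this or-node has one and-child for each element of $s$, labelled by it. A subtree contains the root and is closed under parents; a *derivation subtree* is a subtree containing at most one child of each of its and-nodes and all children of each of its or-nodes. A node is identified with the labels on the path to it (an or-node with the set of labels of its children), so that $T\theta$ is defined for a tree $T$ by applying $\theta$ to all labels, nodes that become equal being identified. A *non-deterministic derivation*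 of $P\cup\{\leftarrow G\}$, $G$ an atom, is a finite or infinite sequence of goals (lists of atoms) $G_0={\leftarrow G},G_1,\dots$, with variants $C_1,C_2,\dots$ of clauses of $P$, whose variables do not occur earlier in the derivation, and substitutions $\theta_1,\theta_2,\dots$, such that if $G_{i}={\leftarrow A_1,\dots,A_k}$ and $C_{i+1}=(A\leftarrow B_1,\dots,B_q)$, then for some (chosen) $m$, $\theta_{i+1}$ is a most general unifier of $A_m$ and $A$, and $G_{i+1}={\leftarrow(A_1,\dots,A_{m-1},B_1,\dots,B_q,A_{m+1},\dots,A_k)\theta_{i+1}}$. Its first $k$ steps have partial answer $\theta_1\cdots\theta_k$ and *generate* the tree $S_k$ defined as follows: $S_0$ is the single root $G$, and $S_{i+1}$ is $S_i\theta_{i+1}$, extended at the leaf at which $A_m\theta_{i+1}$ stands by an or-node with children labelled $B_1\theta_{i+1},\dots,B_q\theta_{i+1}$. As substitution may identify sibling atoms that were resolved differently, an and-node of $S_k$ may have several children. A *pruning* of a tree $S$ is a subtree that keeps exactly one child of each of its and-nodes that has children in $S$, and all children of its or-nodes (so it is $S$ itself if no and-node of $S$ has more than one child). **Theorem (soundness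 and completeness of non-deterministic derivations).** Let $P$ be a logic program and $G$ an atom. 1. *Soundness.* Let $k$ steps of a non-deterministic derivation of $P\cup\{\leftarrow G\}$ have partial answer $\theta$ and generate the tree $S$. Then for some $n$ with $G\theta\in At(n)$, $S$ is a finite subtree of $\bar p(G\theta)$, it has a pruning, and every pruning of $S$ is a derivation subtree of $\bar p(G\theta)$. In particular $S$ itself is a derivation subtree whenever each of its and-nodes has at most one child in $S$. 2. *Completeness.* Let $\theta_0,\theta_1,\dots$ be substitutions and let $m_0,m_1,\dots$ be natural numbers with $G\theta_0\cdots\theta_n\in At(m_n)$ for all $n$. Let $T_n$ be a finite derivation subtree of $\bar p(G\theta_0\cdots\theta_n)$, formed in $At(m_n)$, such that $T_n\theta_{n+1}$ is a subtree of $T_{n+1}$, for all $n\ge 0$. Then there are a finite or infinite non-deterministic derivation of $P\cup\{\leftarrow G\}$ and numbers $k_0\le k_1\le\cdots$, not exceeding its length, such that for every $n$ there is a substitution $\sigma_n$ with $S_{k_n}\sigma_n=T_n$, where $S_{k}$ is the tree generated by the first $k$ steps. -/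

import Mathlib

universe u v w

noncomputable section

namespace LogicProg

/-! ### Atoms, substitutions, programs

An alphabet is a first-order language `L`: its function symbols form the signature, its relation
symbols are the predicate symbols.  The variables are the natural numbers, and terms are
`L.Term ℕ`. -/

/-- Atomic formulae with variables in `α`. -/
structure Atom (L : FirstOrder.Language.{u, v}) (α : Type w) where
  {arity : ℕ}
  pred : L.Relations arity
  args : Fin arity → L.Term α

namespace Atom

variable {L : FirstOrder.Language.{u, v}} {α β γ : Type*}

/-- Simultaneous substitution of terms for the variables of an atom. -/
def subst (A : Atom L α) (θ : α → L.Term β) : Atom L β :=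
  ⟨A.pred, fun i => (A.args i).subst θ⟩

/-- The variables occurring in an atom. -/
def vars (A : Atom L ℕ) : Set ℕ := {x | ∃ i, x ∈ (A.args i).varFinset}

/-- An atom in the variable context `x_0, …, x_{n-1}`, regarded as an atom over all variables. -/
def toVar {n : ℕ} (A : Atom L (Fin n)) : Atom L ℕ :=
  A.subst fun i => FirstOrder.Language.Term.var (i : ℕ)

end Atom

/-- Substitutions. A homomorphism `Ter(Σ) → Ter(Σ)` is the same as its values on variables. -/
abbrev Subst (L : FirstOrder.Language.{u, v}) := ℕ → L.Term ℕ

namespace Subst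

variable {L : FirstOrder.Language.{u, v}}

/-- The composite `θγ`: first `θ`, then `γ`. -/
def comp (θ γ : Subst L) : Subst L := fun x => (θ x).subst γ

/-- The composite `θ_0 θ_1 ⋯ θ_{k-1}` of the first `k` members of a sequence. -/
def compSeq (θ : ℕ → Subst L) : ℕ → Subst L
  | 0 => FirstOrder.Language.Term.var
  | k + 1 => (compSeq θ k).comp (θ k)

/-- The variables occurring in a substitution: those moved by it, and those that occur in the
terms replacing them. -/
def vars (θ : Subst L) : Set ℕ :=
  {x | ∃ y, θ y ≠ FirstOrder.Language.Term.var y ∧ (x = y ∨ x ∈ (θ y).varFinset)}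

end Subst

section Unification

variable {L : FirstOrder.Language.{u, v}}

def IsUnifier (S : Set (Atom L ℕ)) (θ : Subst L) : Prop :=
  ∀ A₁ ∈ S, ∀ A₂ ∈ S, A₁.subst θ = A₂.subst θ

def IsMGU (S : Set (Atom L ℕ)) (θ : Subst L) : Prop :=
  IsUnifier S θ ∧ ∀ σ, IsUnifier S σ → ∃ γ : Subst L, σ = θ.comp γ

end Unification

/-- A clause `head ← body`, with distinct body atoms. -/
structure Clause (L : FirstOrder.Language.{u, v}) where
  head : Atom L ℕ
  body : List (Atom L ℕ)
  nodup : body.Nodup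

namespace Clause

variable {L : FirstOrder.Language.{u, v}}

def vars (C : Clause L) : Set ℕ := {x | x ∈ C.head.vars ∨ ∃ B ∈ C.body, x ∈ B.vars}

/-- `C'` is the image of `C` under a renaming of variables. -/
def IsVariant (C C' : Clause L) : Prop :=
  ∃ π : Equiv.Perm ℕ,
    C'.head = C.head.subst (fun x => FirstOrder.Language.Term.var (π x)) ∧
    C'.body = C.body.map fun B => B.subst (fun x => FirstOrder.Language.Term.var (π x))

open Classical in
/-- The set of atoms `{B_1θ, …, B_qθ}` in the antecedent of the instance `Cθ`. -/
def bodySet (C : Clause L) (θ : Subst L) : Finset (Atom L ℕ) :=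
  (C.body.map fun B => B.subst θ).toFinset

end Clause

/-- A logic program: a finite set of clauses. -/
abbrev Program (L : FirstOrder.Language.{u, v}) := Finset (Clause L)

/-! ### Labelled `&∨`-trees

In a locally injective labelled `&∨`-tree the or-children of an and-node are told apart by the
sets of labels of their children, and the children of an or-node by their labels.  So every node
is determined by the labels on the path to it, and this path is what we use as the node. -/

/-- And-nodes: the root with label `a`, or the child labelled `a` of the or-node below `x` whose
children have label set `s`. -/
inductive AndNode (X : Type w) : Type w
  | root (a : X) : AndNode X
  | child (x : AndNode X) (s : Finset X) (a : X) : AndNode X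

/-- Nodes: and-nodes, and the or-node below the and-node `x` whose children have label set `s`. -/
inductive Node (X : Type w) : Type w
  | and (x : AndNode X) : Node X
  | or (x : AndNode X) (s : Finset X) : Node X

namespace AndNode

variable {X : Type*} {Y : Type*}

def label : AndNode X → X
  | root a => a
  | child _ _ a => a

open Classical in
/-- Relabelling along the path. -/
def map (f : X → Y) : AndNode X → AndNode Y
  | root a => root (f a)
  | child x s a => child (x.map f) (s.image f) (f a)

end AndNode

namespace Node

variable {X : Type*} {Y : Type*}

open Classical in
/-- Relabelling along the path; `Node.map f '' T` is the tree obtained from the tree `T` by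
applying `f` to all labels (and identifying siblings that become indistinguishable). -/
def map (f : X → Y) : Node X → Node Y
  | and x => and (x.map f)
  | or x s => or (x.map f) (s.image f)

/-- The parent of a node (`none` for a root). -/
def parent : Node X → Option (Node X)
  | and (.root _) => none
  | and (.child x s _) => some (or x s)
  | or x _ => some (and x)

end Node

/-- Locally injective `X`-labelled `&∨_c`-trees: and-nodes have countably many children, or-nodes
have finitely many, and the or-node `Node.or x s` has one child for each label in `s`. -/
structure AndOrTree (X : Type w) where
  rootLabel : X
  nodes : Set (Node X)
  root_mem : ∀ a, Node.and (.root a) ∈ nodes ↔ a = rootLabel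
  and_of_or : ∀ x s, Node.or x s ∈ nodes → Node.and x ∈ nodes
  child_mem : ∀ x s a, Node.and (.child x s a) ∈ nodes ↔ Node.or x s ∈ nodes ∧ a ∈ s
  countable : ∀ x, {s | Node.or x s ∈ nodes}.Countable

namespace AndOrTree

variable {X : Type w}

/-- A subtree: a set of nodes containing the root and closed under taking parents. -/
def IsSubtree (T : AndOrTree X) (S : Set (Node X)) : Prop :=
  S ⊆ T.nodes ∧ Node.and (.root T.rootLabel) ∈ S ∧ ∀ y ∈ S, ∀ z, y.parent = some z → z ∈ S

/-- A derivation subtree: at most one child of each of its and-nodes, and all children of each of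
its or-nodes, belong to it. -/
def IsDerivationSubtree (T : AndOrTree X) (S : Set (Node X)) : Prop :=
  T.IsSubtree S ∧
  (∀ x, Node.and x ∈ S → ∀ y ∈ S, ∀ z ∈ S,
    y.parent = some (Node.and x) → z.parent = some (Node.and x) → y = z) ∧
  (∀ x s, Node.or x s ∈ S → ∀ y ∈ T.nodes, y.parent = some (Node.or x s) → y ∈ S)

end AndOrTree

/-- `T` results from the tree `S` by pruning away redundant branches: at every and-node of `T`
that has children in `S`, exactly one of these is kept; nothing else is removed. -/
def IsPruning {X : Type w} (S T : Set (Node X)) : Prop :=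
  T ⊆ S ∧
  (∀ y ∈ S, y.parent = none → y ∈ T) ∧
  (∀ y ∈ T, ∀ z, y.parent = some z → z ∈ T) ∧
  (∀ x, Node.and x ∈ T → (∃ y ∈ S, y.parent = some (Node.and x)) →
    ∃! y, y ∈ T ∧ y.parent = some (Node.and x)) ∧
  (∀ x s, Node.or x s ∈ T → ∀ y ∈ S, y.parent = some (Node.or x s) → y ∈ T)

/-! ### Coalgebras -/

/-- The countable sets of finite subsets of `X`. -/
abbrev PcPf (X : Type w) := {F : Set (Finset X) // F.Countable}

namespace PcPf

variable {X : Type*} {Y : Type*}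

open Classical in
/-- The action on maps, by images. -/
def map (f : X → Y) (F : PcPf X) : PcPf Y :=
  ⟨(fun s => s.image f) '' F.1, F.2.image _⟩

/-- The order on `P_c P_f X` for discretely ordered `X`. -/
def Below (F F' : PcPf X) : Prop := ∀ s ∈ F.1, ∃ t ∈ F'.1, s ⊆ t

end PcPf

/-- Membership in the tree obtained by unfolding a `P_c P_f`-coalgebra `c` from `a`. -/
inductive UnfoldMem {X : Type w} (c : X → PcPf X) (a : X) : Node X → Prop
  | root : UnfoldMem c a (Node.and (.root a))
  | or (x : AndNode X) (s : Finset X) :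
      UnfoldMem c a (Node.and x) → s ∈ (c x.label).1 → UnfoldMem c a (Node.or x s)
  | and (x : AndNode X) (s : Finset X) (b : X) :
      UnfoldMem c a (Node.or x s) → b ∈ s → UnfoldMem c a (Node.and (.child x s b))

/-- The value at `a` of the coalgebra `X → &∨_c-Tree_X` for the cofree comonad that corresponds to
a `P_c P_f`-coalgebra `c`: the root is labelled `a`, and a node labelled `b` has one or-child for
each set in `c b`, whose children are labelled by the elements of that set. -/
def unfold {X : Type w} (c : X → PcPf X) (a : X) : AndOrTree X where
  rootLabel := a
  nodes := {y | UnfoldMem c a y}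
  root_mem b := ⟨fun h => by cases h; rfl, fun h => h ▸ UnfoldMem.root⟩
  and_of_or x s h := by cases h; assumption
  child_mem x s b :=
    ⟨fun h => by cases h with | and _ _ _ h hb => exact ⟨h, hb⟩,
      fun h => UnfoldMem.and x s b h.1 h.2⟩
  countable x := (c x.label).2.mono fun s h => by cases h; assumption

/-- A coalgebra `At → P_c P_f At` in `Lax(𝓛_Σ^op, Poset)`, where `At(n)` is the set of atoms in the
context `x_0, …, x_{n-1}`, a map `n → m` of the Lawvere theory is an `m`-tuple of terms in `n`
variables, and `At` acts by substitution. -/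
structure LaxCoalgebra (L : FirstOrder.Language.{u, v}) where
  app : ∀ n : ℕ, Atom L (Fin n) → PcPf (Atom L (Fin n))
  lax : ∀ (n m : ℕ) (f : Fin m → L.Term (Fin n)) (A : Atom L (Fin m)),
    ((app m A).map fun B => B.subst f).Below (app n (A.subst f))

/-- The tree-valued coalgebra `p̄` corresponding to `p`, at `n`. -/
def LaxCoalgebra.bar {L : FirstOrder.Language.{u, v}} (p : LaxCoalgebra L) (n : ℕ) (A : Atom L (Fin n)) :
    AndOrTree (Atom L (Fin n)) :=
  unfold (p.app n) A

section Induced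

variable {L : FirstOrder.Language.{u, v}} {α β γ : Type*}

theorem term_subst_subst (t : L.Term α) (f : α → L.Term β) (g : β → L.Term γ) :
    (t.subst f).subst g = t.subst fun x => (f x).subst g := by
  induction t with
  | var x => rfl
  | func f ts ih => simp [FirstOrder.Language.Term.subst, ih]

theorem Atom.subst_subst (A : Atom L α) (f : α → L.Term β) (g : β → L.Term γ) :
    (A.subst f).subst g = A.subst fun x => (f x).subst g := by
  simp [Atom.subst, term_subst_subst]

open Classical in
/-- The sets `s ⊆ At(n)` of antecedents of the substitution instances `A ← s` of clauses
of `P`. -/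
def Program.antecedents (P : Program L) (n : ℕ) (A : Atom L (Fin n)) :
    Set (Finset (Atom L (Fin n))) :=
  {s | ∃ C ∈ P, ∃ τ : Subst L, C.head.subst τ = A.toVar ∧ s.image Atom.toVar = C.bodySet τ}

theorem Program.antecedents_countable [Countable (Σ l, L.Functions l)] (P : Program L) (n : ℕ)
    (A : Atom L (Fin n)) : (P.antecedents n A).Countable := by
  classical
  have hU : {a : Atom L (Fin n) |
      ∃ C ∈ P, ∃ B ∈ C.body, ∃ τ : Subst L, B.subst τ = a.toVar}.Countable := by
    have : {a : Atom L (Fin n) | ∃ C ∈ P, ∃ B ∈ C.body, ∃ τ : Subst L, B.subst τ = a.toVar} ⊆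
        ⋃ C ∈ (P : Set (Clause L)), ⋃ B ∈ {B | B ∈ C.body},
          Set.range fun ts : Fin B.arity → L.Term (Fin n) => (⟨B.pred, ts⟩ : Atom L (Fin n)) := by
      rintro ⟨r, ts⟩ ⟨C, hC, ⟨r', ts'⟩, hB, τ, h⟩
      simp only [Set.mem_iUnion]
      refine ⟨C, hC, _, hB, ?_⟩
      simp only [Atom.subst, Atom.toVar, Atom.mk.injEq] at h
      obtain ⟨rfl, h, -⟩ := h
      exact ⟨ts, by simp [eq_of_heq h]⟩
    refine Set.Countable.mono this ?_
    refine P.finite_toSet.countable.biUnion fun C _ => ?_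
    refine (List.finite_toSet C.body).countable.biUnion fun B _ => ?_
    exact Set.countable_range _
  have hF := Set.countable_ofPred_finite_subset hU
  refine Set.Countable.mono ?_ (hF.preimage_of_injOn (f := fun s : Finset (Atom L (Fin n)) =>
    (s : Set (Atom L (Fin n)))) Finset.coe_injective.injOn)
  rintro s ⟨C, hC, τ, -, hs⟩
  refine ⟨s.finite_toSet, fun a ha => ?_⟩
  have : a.toVar ∈ C.bodySet τ := hs ▸ Finset.mem_image_of_mem _ ha
  simp only [Clause.bodySet, List.mem_toFinset, List.mem_map] at this
  obtain ⟨B, hB, h⟩ := this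
  exact ⟨C, hC, B, hB, τ, h⟩

/-- The lax coalgebra induced by a logic program. -/
def Program.coalgebra [Countable (Σ l, L.Functions l)] (P : Program L) : LaxCoalgebra L where
  app n A := ⟨P.antecedents n A, P.antecedents_countable n A⟩
  lax n m f A := by
    classical
    rintro _ ⟨s, ⟨C, hC, τ, hA, hs⟩, rfl⟩
    let g : Subst L := fun x =>
      if h : x < m then (f ⟨x, h⟩).subst fun i => FirstOrder.Language.Term.var (i : ℕ) else .var x
    have hg : ∀ B : Atom L (Fin m), B.toVar.subst g = (B.subst f).toVar := fun B => by
      simp [Atom.toVar, Atom.subst_subst, FirstOrder.Language.Term.subst, g]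
    have e : (s.image fun B => B.subst f) ∈ P.antecedents n (A.subst f) := by
      refine ⟨C, hC, τ.comp g, ?_, ?_⟩
      · rw [← hg, ← hA, Atom.subst_subst]; rfl
      · have h1 : C.bodySet (τ.comp g) = (C.bodySet τ).image fun B => B.subst g := by
          ext B
          simp only [Clause.bodySet, List.mem_toFinset, List.mem_map, Finset.mem_image,
            exists_exists_and_eq_and, Atom.subst_subst]
          rfl
        rw [h1, ← hs, Finset.image_image, Finset.image_image]
        exact Finset.image_congr fun B _ => (hg B).symm
    refine ⟨_, e, fun B hB => ?_⟩
    convert hB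

end Induced

/-! ### Non-deterministic derivations -/

section Derivations

variable {L : FirstOrder.Language.{u, v}}

/-- The goal `H` is non-deterministically derived from the goal `G` and the clause `C`, by
resolving the atom at position `m` of `G` using the mgu `θ`. -/
def Derived (G : List (Atom L ℕ)) (m : ℕ) (C : Clause L) (θ : Subst L) (H : List (Atom L ℕ)) :
    Prop :=
  ∃ A, G[m]? = some A ∧ IsMGU {A, C.head} θ ∧
    H = (G.take m ++ C.body ++ G.drop (m + 1)).map fun B => B.subst θ

/-- A finite or infinite non-deterministic derivation of `P ∪ {← G}`, with goals `goal 0, goal 1, …`;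
the step from `goal i` to `goal (i+1)`, for `i < length`, resolves the atom at position `pos i` with
the variant `clause i` of a clause of `P`, using the mgu `mgu i`. Variables are standardised apart:
those of `clause i` do not appear in the derivation up to `goal i`. The values of the sequences
beyond `length` are irrelevant. -/
structure Derivation (P : Program L) (G : Atom L ℕ) where
  length : ℕ∞
  goal : ℕ → List (Atom L ℕ)
  pos : ℕ → ℕ
  clause : ℕ → Clause L
  mgu : ℕ → Subst L
  goal_zero : goal 0 = [G]
  variant : ∀ i : ℕ, (i : ℕ∞) < length → ∃ C ∈ P, C.IsVariant (clause i)
  apart : ∀ i : ℕ, (i : ℕ∞) < length → ∀ x ∈ (clause i).vars,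
    (∀ j ≤ i, ∀ B ∈ goal j, x ∉ B.vars) ∧ ∀ j < i, x ∉ (clause j).vars ∧ x ∉ (mgu j).vars
  step : ∀ i : ℕ, (i : ℕ∞) < length → Derived (goal i) (pos i) (clause i) (mgu i) (goal (i + 1))

namespace Derivation

variable {P : Program L} {G : Atom L ℕ}

/-- The partial answer `θ_1 ⋯ θ_k` after `k` steps. -/
def answer (D : Derivation P G) (k : ℕ) : Subst L := Subst.compSeq D.mgu k

/-- The nodes of `D.tree k` at which the atoms of `D.goal k` stand, in the same order. -/
def leaves (D : Derivation P G) : ℕ → List (AndNode (Atom L ℕ))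
  | 0 => [.root G]
  | k + 1 =>
    let app : Atom L ℕ → Atom L ℕ := fun B => B.subst (D.mgu k)
    ((D.leaves k).take (D.pos k)).map (AndNode.map app) ++
      ((D.leaves k)[D.pos k]?.toList.flatMap fun x => (D.clause k).body.map fun B =>
        .child (x.map app) ((D.clause k).bodySet (D.mgu k)) (app B)) ++
      ((D.leaves k).drop (D.pos k + 1)).map (AndNode.map app)

/-- The tree generated by the first `k` steps of `D`. It starts as the root `G`; the step with mgu
`θ` and clause `C` that resolves the atom at the leaf `x` applies `θ` to the whole tree, and extends
it at `xθ` by an or-node whose children are labelled by the atoms in the body of `Cθ`. -/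
def tree (D : Derivation P G) : ℕ → Set (Node (Atom L ℕ))
  | 0 => {Node.and (.root G)}
  | k + 1 =>
    let app : Atom L ℕ → Atom L ℕ := fun B => B.subst (D.mgu k)
    let s := (D.clause k).bodySet (D.mgu k)
    Node.map app '' D.tree k ∪
      {y | ∃ x, (D.leaves k)[D.pos k]? = some x ∧
        (y = Node.or (x.map app) s ∨ ∃ b ∈ s, y = Node.and (.child (x.map app) s b))}

end Derivation

end Derivations

end LogicProg

end

/-!
Both halves compare the trees generated by a derivation with one syntactic notion, resolution trees
(`IsResolutionTree`): parent-closed trees over atoms in all variables in which every or-node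
carries all antecedents of some instance of a clause of the program. These are closed under
substitution and under resolving a leaf, so every tree generated by a derivation is one
(`Derivation.isResolutionTree`). Transported along the injection of `At(n)` into all atoms, the
finite subtrees of `p̄(A)` whose or-nodes have all their children are resolution trees with root
`A`, and conversely.

For soundness, the tree generated by finitely many steps is finite, hence contains only variables
below some `n`, and so it comes from a set of nodes over `At(n)` (`Node.BoundedBy.mem_range`),
which `IsResolutionTree.isSubtree` places inside `p̄(Gθ)`. A pruning exists by choosing one child of
each and-node that has any; that it keeps only one of them makes it a derivation subtree.

Completeness is a lifting argument. Suppose that a finite derivation has generated `S`, that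
`Sσ ⊆ T` for a finite derivation subtree `T`, and that some leaf `x` of `S` is such that `xσ` has a
child in `T`. This child comes from an instance of a clause; a fresh variant of the clause lets `σ`
be extended to a unifier of the label of `x` and the head of the variant. By the unification theorem
(`hasFiniteMGU_of_unifies`) there is a most general unifier which moves finitely many variables only,
so that fresh variables remain available later, and the extended `σ` factors through it
(`Derivation.exists_lift_step`). Several leaves may have the same image in `T`, so the steps cannot
be counted by the nodes of `T`; instead a leaf of depth `d` gets the weight `(M + 1) ^ (H - d)`,
where `M` bounds the lengths of the clause bodies and `H` exceeds all depths in `T`, and the total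
weight decreases. When no step is possible, `Sσ = T`, since an and-node of `S` is a leaf or has been
resolved, and an and-node of `T` has at most one child (`Derivation.exists_lift`). As
`T_nθ_{n+1} ⊆ T_{n+1}`, the derivation obtained for `T_n` can be prolonged for `T_{n+1}`; the
resulting chain of finite derivations has a limit (`Derivation.exists_limit`).
-/

namespace LogicProg

open FirstOrder.Language (Term)

variable {L : FirstOrder.Language.{u, v}}

/-! ### Terms and substitutions -/

theorem term_subst_congr {α β : Type*} [DecidableEq α] {f g : α → L.Term β} (t : L.Term α)
    (h : ∀ x ∈ t.varFinset, f x = g x) : t.subst f = t.subst g := by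
  induction t with
  | var x => exact h x (by simp [Term.varFinset])
  | func F ts ih =>
    simp only [Term.subst, Term.func.injEq, heq_eq_eq, true_and]
    funext i
    exact ih i fun x hx => h x (by simpa [Term.varFinset] using ⟨i, hx⟩)

theorem term_subst_var {α : Type*} (t : L.Term α) : t.subst Term.var = t := by
  induction t with
  | var x => rfl
  | func F ts ih => simp [Term.subst, ih]

theorem mem_varFinset_subst {α β : Type*} [DecidableEq α] [DecidableEq β] (f : α → L.Term β)
    (t : L.Term α) (x : β) :
    x ∈ (t.subst f).varFinset ↔ ∃ y ∈ t.varFinset, x ∈ (f y).varFinset := by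
  induction t with
  | var y => simp [Term.varFinset, Term.subst]
  | func F ts ih =>
    simp only [Term.subst, Term.varFinset, Finset.mem_biUnion, Finset.mem_univ, true_and, ih]
    exact ⟨fun ⟨i, y, hy, h⟩ => ⟨y, ⟨i, hy⟩, h⟩, fun ⟨y, ⟨i, hy⟩, h⟩ => ⟨i, y, hy, h⟩⟩

/-- The number of symbols in a term. -/
def termSize {α : Type*} : L.Term α → ℕ
  | .var _ => 1
  | .func _ ts => 1 + ∑ i, termSize (ts i)

theorem termSize_pos {α : Type*} (t : L.Term α) : 0 < termSize t := by
  cases t <;> simp [termSize]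

theorem termSize_le_subst {α β : Type*} [DecidableEq α] (f : α → L.Term β) (t : L.Term α) {x : α}
    (hx : x ∈ t.varFinset) : termSize (f x) ≤ termSize (t.subst f) := by
  induction t with
  | var y =>
    simp only [Term.varFinset, Finset.mem_singleton] at hx
    subst hx; rfl
  | func F ts ih =>
    simp only [Term.varFinset, Finset.mem_biUnion, Finset.mem_univ, true_and] at hx
    obtain ⟨i, hi⟩ := hx
    have := Finset.single_le_sum (f := fun j => termSize ((ts j).subst f))
      (fun _ _ => Nat.zero_le _) (Finset.mem_univ i)
    simp only [Term.subst, termSize]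
    exact (ih i hi).trans (this.trans (Nat.le_add_left _ _))

/-- The occurs check: a variable with the same instance as a term other than itself does not occur
in that term, since the instances would differ in size. -/
theorem notMem_varFinset_of_unifies {α β : Type*} [DecidableEq α] {f : α → L.Term β} {x : α}
    {t : L.Term α} (ht : t ≠ .var x) (h : f x = t.subst f) : x ∉ t.varFinset := by
  intro hx
  cases t with
  | var y =>
    simp only [Term.varFinset, Finset.mem_singleton] at hx
    exact ht (by rw [hx])
  | func F ts =>
    simp only [Term.varFinset, Finset.mem_biUnion, Finset.mem_univ, true_and] at hx
    obtain ⟨i, hi⟩ := hx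
    have h1 := Finset.single_le_sum (f := fun j => termSize ((ts j).subst f))
      (fun _ _ => Nat.zero_le _) (Finset.mem_univ i)
    have h2 := termSize_le_subst f _ hi
    have h3 := congrArg termSize h
    simp only [Term.subst, termSize] at h3
    omega

theorem term_subst_comp (t : L.Term ℕ) (θ γ : Subst L) :
    (t.subst θ).subst γ = t.subst (θ.comp γ) :=
  term_subst_subst t θ γ

theorem Atom.subst_comp (A : Atom L ℕ) (θ γ : Subst L) :
    (A.subst θ).subst γ = A.subst (θ.comp γ) :=
  Atom.subst_subst A θ γ

/-! ### Unification -/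

/-- `σ` solves the system of equations `E` between terms. -/
def Unifies (σ : Subst L) (E : List (L.Term ℕ × L.Term ℕ)) : Prop :=
  ∀ p ∈ E, p.1.subst σ = p.2.subst σ

/-- `E` has a most general solution that moves only finitely many variables. -/
def HasFiniteMGU (E : List (L.Term ℕ × L.Term ℕ)) : Prop :=
  ∃ θ : Subst L, Unifies θ E ∧ (∀ σ, Unifies σ E → ∃ γ : Subst L, σ = θ.comp γ) ∧
    {x | θ x ≠ .var x}.Finite

theorem HasFiniteMGU.congr {E E' : List (L.Term ℕ × L.Term ℕ)} (h : HasFiniteMGU E)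
    (e : ∀ σ, Unifies σ E ↔ Unifies σ E') : HasFiniteMGU E' := by
  obtain ⟨θ, h1, h2, h3⟩ := h
  exact ⟨θ, (e θ).1 h1, fun σ hσ => h2 σ ((e σ).2 hσ), h3⟩

/-- A solution of `x = t` absorbs the elementary substitution `x ↦ t`. -/
theorem update_comp_self {σ : Subst L} {x : ℕ} {t : L.Term ℕ} (h : σ x = t.subst σ) :
    Subst.comp (Function.update Term.var x t) σ = σ := by
  funext y
  by_cases hy : y = x
  · subst hy; simp [Subst.comp, h]
  · simp [Subst.comp, hy, Term.subst]

/-- Variable elimination: a solved equation `x = t` reduces the system `E` to its instance under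
`x ↦ t`, in which `x` no longer occurs. -/
theorem hasFiniteMGU_eliminate {E : List (L.Term ℕ × L.Term ℕ)} {x : ℕ} {t : L.Term ℕ}
    (hx : x ∉ t.varFinset)
    (h : HasFiniteMGU (E.map fun p => (p.1.subst (Function.update Term.var x t),
      p.2.subst (Function.update Term.var x t)))) :
    HasFiniteMGU ((.var x, t) :: E) := by
  obtain ⟨θ, h1, h2, h3⟩ := h
  have ht : ∀ σ : Subst L, t.subst (Subst.comp (Function.update Term.var x t) σ) = t.subst σ :=
    fun σ => term_subst_congr t fun y hy => by
      have : y ≠ x := fun e => hx (e ▸ hy)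
      simp [Subst.comp, this, Term.subst]
  refine ⟨Subst.comp (Function.update Term.var x t) θ, ?_, ?_, ?_⟩
  · intro p hp
    rcases List.mem_cons.1 hp with rfl | hp
    · rw [ht]; simp [Term.subst, Subst.comp]
    · have := h1 _ (List.mem_map_of_mem hp)
      simpa only [term_subst_comp] using this
  · intro σ hσ
    have hσx : σ x = t.subst σ := hσ _ List.mem_cons_self
    obtain ⟨γ, hγ⟩ := h2 σ (by
      intro p hp
      obtain ⟨q, hq, rfl⟩ := List.mem_map.1 hp
      have := hσ q (List.mem_cons_of_mem _ hq)
      rw [← update_comp_self hσx] at this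
      simpa only [term_subst_comp] using this)
    refine ⟨γ, ?_⟩
    rw [← update_comp_self hσx, hγ]
    funext y
    simp only [Subst.comp, term_subst_subst]
    rfl
  · refine (h3.union (Set.finite_singleton x)).subset fun y hy => ?_
    by_cases hyx : y = x
    · exact Or.inr hyx
    · left
      simpa [Subst.comp, hyx, Term.subst] using hy

/-- The unification theorem for finite systems of equations, by induction on the set of variables
and on the size of the left-hand sides. -/
theorem hasFiniteMGU_of_unifies (V : Finset ℕ) : ∀ (n : ℕ) (E : List (L.Term ℕ × L.Term ℕ)),
    (E.map fun p => termSize p.1).sum ≤ n →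
    (∀ p ∈ E, p.1.varFinset ⊆ V ∧ p.2.varFinset ⊆ V) → (∃ σ, Unifies σ E) → HasFiniteMGU E := by
  induction V using Finset.strongInduction with
  | H V ihV =>
  -- Eliminating the variable `x` leads to a system in fewer variables.
  have elim : ∀ (E : List (L.Term ℕ × L.Term ℕ)) (x : ℕ) (t : L.Term ℕ), t ≠ .var x →
      x ∈ V → t.varFinset ⊆ V → (∀ p ∈ E, p.1.varFinset ⊆ V ∧ p.2.varFinset ⊆ V) →
      (∃ σ, Unifies σ ((.var x, t) :: E)) → HasFiniteMGU ((.var x, t) :: E) := by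
    rintro E x t htx hxV htV hE ⟨σ, hσ⟩
    have hσx : σ x = t.subst σ := hσ _ List.mem_cons_self
    have hxt := notMem_varFinset_of_unifies htx hσx
    have key : ∀ s : L.Term ℕ, s.varFinset ⊆ V →
        (s.subst (Function.update Term.var x t)).varFinset ⊆ V.erase x := by
      intro s hs z hz
      obtain ⟨y, hy, hz⟩ := (mem_varFinset_subst _ _ _).1 hz
      by_cases hyx : y = x
      · subst hyx
        rw [Function.update_self] at hz
        exact Finset.mem_erase.2 ⟨fun e => hxt (e ▸ hz), htV hz⟩
      · rw [Function.update_of_ne hyx] at hz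
        simp only [Term.varFinset, Finset.mem_singleton] at hz
        subst hz
        exact Finset.mem_erase.2 ⟨hyx, hs hy⟩
    refine hasFiniteMGU_eliminate hxt (ihV _ (Finset.erase_ssubset hxV) _ _ le_rfl ?_ ⟨σ, ?_⟩)
    · intro p hp
      obtain ⟨q, hq, rfl⟩ := List.mem_map.1 hp
      exact ⟨key _ (hE q hq).1, key _ (hE q hq).2⟩
    · intro p hp
      obtain ⟨q, hq, rfl⟩ := List.mem_map.1 hp
      have := hσ q (List.mem_cons_of_mem _ hq)
      rw [← update_comp_self hσx] at this
      simpa only [term_subst_comp] using this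
  intro n
  induction n with
  | zero =>
    intro E hn hE hσ
    cases E with
    | nil => exact ⟨Term.var, by simp [Unifies], fun σ _ => ⟨σ, rfl⟩, by simp⟩
    | cons p E =>
      have := termSize_pos p.1
      simp only [List.map_cons, List.sum_cons] at hn
      omega
  | succ n ih =>
    intro E hn hE hσ
    cases E with
    | nil => exact ⟨Term.var, by simp [Unifies], fun σ _ => ⟨σ, rfl⟩, by simp⟩
    | cons p E =>
      obtain ⟨t, s⟩ := p
      have hE' : ∀ p ∈ E, p.1.varFinset ⊆ V ∧ p.2.varFinset ⊆ V :=
        fun p hp => hE p (List.mem_cons_of_mem _ hp)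
      obtain ⟨ht, hs⟩ := hE (t, s) List.mem_cons_self
      have swap : ∀ σ, Unifies σ ((s, t) :: E) ↔ Unifies σ ((t, s) :: E) := fun σ => by
        simp only [Unifies, List.forall_mem_cons]
        rw [eq_comm]
      by_cases hts : t = s
      · have e : ∀ σ, Unifies σ E ↔ Unifies σ ((t, s) :: E) := fun σ => by
          simp [Unifies, hts]
        refine (ih E ?_ hE' ?_).congr e
        · have := termSize_pos t
          simp only [List.map_cons, List.sum_cons] at hn
          omega
        · exact hσ.imp fun σ => (e σ).2
      cases t with
      | var x =>
        exact elim E x s (Ne.symm hts) (ht (by simp [Term.varFinset])) hs hE' hσ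
      | func F ts =>
        rename_i l
        cases s with
        | var x =>
          exact (elim E x (.func F ts) hts (hs (by simp [Term.varFinset])) ht hE'
            (hσ.imp fun σ => (swap σ).2)).congr swap
        | func F' ss =>
          -- Decomposition: the equation is replaced by those between the arguments.
          obtain ⟨σ, hσ⟩ := hσ
          have h0 := hσ _ List.mem_cons_self
          simp only [Term.subst, Term.func.injEq] at h0
          obtain ⟨rfl, hF, -⟩ := h0
          obtain rfl := eq_of_heq hF
          have e : ∀ σ, Unifies σ (List.ofFn (fun i => (ts i, ss i)) ++ E) ↔
              Unifies σ ((.func F ts, .func F ss) :: E) := fun σ => by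
            simp only [Unifies, List.forall_mem_cons, List.forall_mem_append,
              List.forall_mem_ofFn_iff, Term.subst, Term.func.injEq, heq_eq_eq, true_and,
              funext_iff]
          refine (ih _ ?_ ?_ ⟨σ, (e σ).2 hσ⟩).congr e
          · simp only [List.map_cons, List.sum_cons, termSize] at hn
            simp only [List.map_append, List.map_ofFn, List.sum_append, List.sum_ofFn,
              Function.comp_apply]
            omega
          · intro p hp
            rcases List.mem_append.1 hp with hp | hp
            · obtain ⟨i, rfl⟩ := (List.mem_ofFn' _ _).1 hp
              refine ⟨fun y hy => ht ?_, fun y hy => hs ?_⟩ <;>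
                simp only [Term.varFinset, Finset.mem_biUnion, Finset.mem_univ, true_and] <;>
                exact ⟨i, hy⟩
            · exact hE' p hp

theorem isUnifier_pair {A B : Atom L ℕ} {σ : Subst L} :
    IsUnifier {A, B} σ ↔ A.subst σ = B.subst σ := by
  simp only [IsUnifier, Set.mem_insert_iff, Set.mem_singleton_iff, forall_eq_or_imp, forall_eq]
  exact ⟨fun h => h.1.2, fun h => ⟨⟨trivial, h⟩, h.symm, trivial⟩⟩

/-- Unifiable atoms have a most general unifier that moves only finitely many variables. -/
theorem exists_isMGU {A B : Atom L ℕ} {σ : Subst L} (h : A.subst σ = B.subst σ) :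
    ∃ θ : Subst L, IsMGU {A, B} θ ∧ {x | θ x ≠ .var x}.Finite := by
  obtain ⟨p, ts⟩ := A
  obtain ⟨q, ss⟩ := B
  have h' := h
  simp only [Atom.subst, Atom.mk.injEq] at h'
  obtain ⟨rfl, hp, -⟩ := h'
  obtain rfl := eq_of_heq hp
  have e : ∀ σ : Subst L, Unifies σ (List.ofFn fun i => (ts i, ss i)) ↔
      IsUnifier {⟨p, ts⟩, ⟨p, ss⟩} σ := fun σ => by
    rw [isUnifier_pair]
    simp [Unifies, Atom.subst, funext_iff]
  obtain ⟨θ, h1, h2, h3⟩ := hasFiniteMGU_of_unifies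
    (Finset.univ.biUnion fun i => (ts i).varFinset ∪ (ss i).varFinset) _
    (List.ofFn fun i => (ts i, ss i)) le_rfl
    (by
      intro p hp
      obtain ⟨i, rfl⟩ := (List.mem_ofFn' _ _).1 hp
      exact ⟨Finset.subset_union_left.trans (Finset.subset_biUnion_of_mem (fun i =>
          (ts i).varFinset ∪ (ss i).varFinset) (Finset.mem_univ i)),
        Finset.subset_union_right.trans (Finset.subset_biUnion_of_mem (fun i =>
          (ts i).varFinset ∪ (ss i).varFinset) (Finset.mem_univ i))⟩)
    ⟨σ, (e σ).2 (isUnifier_pair.2 h)⟩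
  exact ⟨θ, ⟨(e θ).1 h1, fun σ hσ => h2 σ ((e σ).2 hσ)⟩, h3⟩

theorem Subst.vars_finite {θ : Subst L} (h : {x | θ x ≠ .var x}.Finite) : θ.vars.Finite := by
  refine (h.union (h.biUnion fun y _ => (θ y).varFinset.finite_toSet)).subset ?_
  rintro x ⟨y, hy, rfl | hx⟩
  · exact Or.inl hy
  · exact Or.inr (Set.mem_biUnion hy hx)

/-! ### Relabelling of nodes -/

section Relabelling

variable {X Y Z : Type*}

theorem AndNode.map_map (f : X → Y) (g : Y → Z) (x : AndNode X) :
    (x.map f).map g = x.map fun a => g (f a) := by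
  induction x with
  | root a => rfl
  | child x s a ih =>
    simp only [AndNode.map, ih, Finset.image_image]
    rfl

theorem Node.map_map (f : X → Y) (g : Y → Z) (y : Node X) :
    (y.map f).map g = y.map fun a => g (f a) := by
  cases y with
  | and x => simp only [Node.map, AndNode.map_map]
  | or x s =>
    simp only [Node.map, AndNode.map_map, Finset.image_image]
    rfl

theorem AndNode.map_id (x : AndNode X) : x.map (fun a => a) = x := by
  induction x with
  | root a => rfl
  | child x s a ih => simp only [AndNode.map, ih, Finset.image_id']

theorem Node.map_id (y : Node X) : y.map (fun a => a) = y := by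
  cases y with
  | and x => simp only [Node.map, AndNode.map_id]
  | or x s => simp only [Node.map, AndNode.map_id, Finset.image_id']

@[simp]
theorem AndNode.label_map (f : X → Y) (x : AndNode X) : (x.map f).label = f x.label := by
  cases x <;> rfl

@[simp]
theorem AndNode.label_child (x : AndNode X) (s : Finset X) (a : X) :
    (AndNode.child x s a).label = a :=
  rfl

theorem Node.parent_map (f : X → Y) (y : Node X) :
    (y.map f).parent = y.parent.map (Node.map f) := by
  rcases y with (_ | _) | _ <;> rfl

theorem AndNode.map_injective {f : X → Y} (hf : Function.Injective f) :
    Function.Injective (AndNode.map f) := by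
  classical
  intro x
  induction x with
  | root a =>
    rintro (b | ⟨y, t, b⟩) h <;> simp only [AndNode.map, AndNode.root.injEq, reduceCtorEq] at h
    rw [hf h]
  | child x s a ih =>
    rintro (b | ⟨y, t, b⟩) h <;>
      simp only [AndNode.map, AndNode.child.injEq, reduceCtorEq] at h
    rw [ih h.1, Finset.image_injective hf h.2.1, hf h.2.2]

theorem Node.map_injective {f : X → Y} (hf : Function.Injective f) :
    Function.Injective (Node.map f) := by
  classical
  rintro (x | ⟨x, s⟩) (y | ⟨y, t⟩) h <;>
    simp only [Node.map, Node.and.injEq, Node.or.injEq, reduceCtorEq] at h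
  · rw [AndNode.map_injective hf h]
  · rw [AndNode.map_injective hf h.1, Finset.image_injective hf h.2]

/-- The number of or-nodes above an and-node. -/
def AndNode.depth : AndNode X → ℕ
  | .root _ => 0
  | .child x _ _ => x.depth + 1

@[simp]
theorem AndNode.depth_map (f : X → Y) (x : AndNode X) : (x.map f).depth = x.depth := by
  induction x with
  | root a => rfl
  | child x s a ih => simp only [AndNode.map, AndNode.depth, ih]

end Relabelling

theorem AndNode.map_subst_comp (x : AndNode (Atom L ℕ)) (θ γ : Subst L) :
    (x.map fun B => B.subst θ).map (fun B => B.subst γ) = x.map fun B => B.subst (θ.comp γ) := by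
  simp only [AndNode.map_map, Atom.subst_comp]

theorem Node.map_subst_comp (y : Node (Atom L ℕ)) (θ γ : Subst L) :
    (y.map fun B => B.subst θ).map (fun B => B.subst γ) = y.map fun B => B.subst (θ.comp γ) := by
  simp only [Node.map_map, Atom.subst_comp]

theorem Node.image_map_subst_comp (S : Set (Node (Atom L ℕ))) (θ γ : Subst L) :
    Node.map (fun B => B.subst γ) '' (Node.map (fun B => B.subst θ) '' S) =
      Node.map (fun B => B.subst (θ.comp γ)) '' S := by
  simp only [Set.image_image, Node.map_subst_comp]

/-! ### Finiteness of the sets of variables -/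

theorem Atom.vars_finite (A : Atom L ℕ) : A.vars.Finite := by
  have : A.vars = ⋃ i, ((A.args i).varFinset : Set ℕ) := by
    ext x; simp [Atom.vars]
  rw [this]
  exact Set.finite_iUnion fun i => Finset.finite_toSet _

theorem Clause.vars_finite (C : Clause L) : C.vars.Finite := by
  refine (C.head.vars_finite.union
    ((List.finite_toSet C.body).biUnion fun B _ => B.vars_finite)).subset ?_
  rintro x (h | ⟨B, hB, h⟩)
  · exact Or.inl h
  · exact Or.inr (Set.mem_biUnion (show B ∈ {B | B ∈ C.body} from hB) h)

theorem exists_lt_of_finite {s : Set ℕ} (hs : s.Finite) : ∃ N, ∀ x ∈ s, x < N := by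
  obtain ⟨N, hN⟩ := hs.bddAbove
  exact ⟨N + 1, fun x hx => Nat.lt_succ_of_le (hN hx)⟩

theorem Atom.subst_congr {α : Type*} {A : Atom L ℕ} {σ τ : ℕ → L.Term α}
    (h : ∀ x ∈ A.vars, σ x = τ x) : A.subst σ = A.subst τ := by
  simp only [Atom.subst, Atom.mk.injEq, heq_eq_eq, true_and]
  funext i
  exact term_subst_congr _ fun x hx => h x ⟨i, hx⟩

theorem Atom.subst_var {α : Type*} (A : Atom L α) : A.subst Term.var = A := by
  simp [Atom.subst, term_subst_var]

theorem Clause.bodySet_congr {C : Clause L} {σ τ : Subst L} (h : ∀ x ∈ C.vars, σ x = τ x) :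
    C.bodySet σ = C.bodySet τ := by
  unfold Clause.bodySet
  congr 1
  exact List.map_congr_left fun B hB => Atom.subst_congr fun x hx => h x (Or.inr ⟨B, hB, hx⟩)

theorem Clause.head_subst_congr {C : Clause L} {σ τ : Subst L} (h : ∀ x ∈ C.vars, σ x = τ x) :
    C.head.subst σ = C.head.subst τ :=
  Atom.subst_congr fun x hx => h x (Or.inl hx)

theorem Clause.mem_bodySet {C : Clause L} {σ : Subst L} {A : Atom L ℕ} :
    A ∈ C.bodySet σ ↔ ∃ B ∈ C.body, B.subst σ = A := by
  simp [Clause.bodySet]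

open Classical in
theorem Clause.bodySet_comp (C : Clause L) (σ τ : Subst L) :
    C.bodySet (σ.comp τ) = (C.bodySet σ).image fun B => B.subst τ := by
  ext A
  simp [Clause.mem_bodySet, Atom.subst_comp]

theorem Clause.IsVariant.exists_instance {C C' : Clause L} (h : C.IsVariant C') (θ : Subst L) :
    ∃ τ : Subst L, C.head.subst τ = C'.head.subst θ ∧ C.bodySet τ = C'.bodySet θ := by
  obtain ⟨π, h1, h2⟩ := h
  refine ⟨fun x => θ (π x), ?_, ?_⟩
  · rw [h1, Atom.subst_subst]; rfl
  · ext A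
    simp [Clause.mem_bodySet, h2, Atom.subst_subst, Term.subst]

/-- A substitution acts on the node `y` through its values below `N` only; equivalently, all
variables in the labels on the path `y` are below `N`. -/
def Node.BoundedBy (N : ℕ) (y : Node (Atom L ℕ)) : Prop :=
  ∀ σ τ : Subst L, (∀ x < N, σ x = τ x) →
    y.map (fun B => B.subst σ) = y.map fun B => B.subst τ

theorem Node.BoundedBy.mono {N M : ℕ} {y : Node (Atom L ℕ)} (h : y.BoundedBy N) (hNM : N ≤ M) :
    y.BoundedBy M :=
  fun σ τ e => h σ τ fun x hx => e x (hx.trans_le hNM)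

theorem Atom.exists_bound (A : Atom L ℕ) :
    ∃ N, ∀ σ τ : Subst L, (∀ x < N, σ x = τ x) → A.subst σ = A.subst τ := by
  obtain ⟨N, hN⟩ := exists_lt_of_finite A.vars_finite
  exact ⟨N, fun σ τ h => Atom.subst_congr fun x hx => h x (hN x hx)⟩

theorem exists_bound_finset (s : Finset (Atom L ℕ)) :
    ∃ N, ∀ σ τ : Subst L, (∀ x < N, σ x = τ x) → ∀ A ∈ s, A.subst σ = A.subst τ := by
  obtain ⟨N, hN⟩ := exists_lt_of_finite
    (s.finite_toSet.biUnion fun A _ => A.vars_finite)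
  exact ⟨N, fun σ τ h A hA => Atom.subst_congr fun x hx => h x (hN x (Set.mem_biUnion hA hx))⟩

open Classical in
theorem AndNode.exists_boundedBy (x : AndNode (Atom L ℕ)) :
    ∃ N, (Node.and x).BoundedBy N := by
  induction x with
  | root A =>
    obtain ⟨N, hN⟩ := A.exists_bound
    exact ⟨N, fun σ τ h => by simp only [Node.map, AndNode.map, hN σ τ h]⟩
  | child x s A ih =>
    obtain ⟨N₁, h₁⟩ := A.exists_bound
    obtain ⟨N₂, h₂⟩ := exists_bound_finset s
    obtain ⟨N₃, h₃⟩ := ih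
    refine ⟨max N₁ (max N₂ N₃), fun σ τ h => ?_⟩
    have e₁ := h₁ σ τ fun x hx => h x (hx.trans_le (le_max_left _ _))
    have e₂ := h₂ σ τ fun x hx =>
      h x (hx.trans_le ((le_max_left _ _).trans (le_max_right _ _)))
    have e₃ := h₃ σ τ fun x hx =>
      h x (hx.trans_le ((le_max_right _ _).trans (le_max_right _ _)))
    simp only [Node.map, Node.and.injEq] at e₃
    simp only [Node.map, AndNode.map, e₁, e₃, Finset.image_congr fun A hA => e₂ A hA]

open Classical in
theorem Node.exists_boundedBy (y : Node (Atom L ℕ)) : ∃ N, y.BoundedBy N := by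
  cases y with
  | and x => exact x.exists_boundedBy
  | or x s =>
    obtain ⟨N₂, h₂⟩ := exists_bound_finset s
    obtain ⟨N₃, h₃⟩ := x.exists_boundedBy
    refine ⟨max N₂ N₃, fun σ τ h => ?_⟩
    have e₂ := h₂ σ τ fun x hx => h x (hx.trans_le (le_max_left _ _))
    have e₃ := h₃ σ τ fun x hx => h x (hx.trans_le (le_max_right _ _))
    simp only [Node.map, Node.and.injEq] at e₃
    simp only [Node.map, e₃, Finset.image_congr fun A hA => e₂ A hA]

theorem exists_boundedBy_of_finite {S : Set (Node (Atom L ℕ))} (hS : S.Finite) :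
    ∃ N, ∀ y ∈ S, y.BoundedBy N := by
  choose f hf using fun y : Node (Atom L ℕ) => y.exists_boundedBy
  obtain ⟨N, hN⟩ := (hS.image f).bddAbove
  exact ⟨N, fun y hy => (hf y).mono (hN (Set.mem_image_of_mem f hy))⟩

/-! ### Resolution trees -/

/-- Trees of resolution steps below the atom `A`, on the level of all variables: the branching at
every or-node is an instance of a clause of `P` with all its antecedents. An and-node may have
several or-children, so images of such trees under substitutions are again of this kind. -/
structure IsResolutionTree (P : Program L) (A : Atom L ℕ) (S : Set (Node (Atom L ℕ))) : Prop where
  root_mem : ∀ a, Node.and (.root a) ∈ S ↔ a = A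
  parent_mem : ∀ y ∈ S, ∀ z, y.parent = some z → z ∈ S
  child_mem : ∀ x s, Node.or x s ∈ S → ∀ a ∈ s, Node.and (.child x s a) ∈ S
  mem_of_child : ∀ x s a, Node.and (.child x s a) ∈ S → a ∈ s
  instance_of_or : ∀ x s, Node.or x s ∈ S →
    ∃ C ∈ P, ∃ τ : Subst L, C.head.subst τ = x.label ∧ C.bodySet τ = s

theorem isResolutionTree_root (P : Program L) (A : Atom L ℕ) :
    IsResolutionTree P A {Node.and (.root A)} where
  root_mem a := by simp
  parent_mem := by rintro _ rfl z hz; simp [Node.parent] at hz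
  child_mem := by simp
  mem_of_child := by simp
  instance_of_or := by simp

open Classical in
theorem IsResolutionTree.image {P : Program L} {A : Atom L ℕ} {S : Set (Node (Atom L ℕ))}
    (h : IsResolutionTree P A S) (σ : Subst L) :
    IsResolutionTree P (A.subst σ) (Node.map (fun B => B.subst σ) '' S) where
  root_mem a := by
    constructor
    · rintro ⟨(⟨b⟩ | _) | _, hy, e⟩ <;>
        simp only [Node.map, AndNode.map, Node.and.injEq, AndNode.root.injEq, reduceCtorEq] at e
      rw [← e, (h.root_mem b).1 hy]
    · rintro rfl
      exact ⟨_, (h.root_mem A).2 rfl, rfl⟩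
  parent_mem := by
    rintro _ ⟨y, hy, rfl⟩ z hz
    rw [Node.parent_map, Option.map_eq_some_iff] at hz
    obtain ⟨w, hw, rfl⟩ := hz
    exact ⟨w, h.parent_mem y hy w hw, rfl⟩
  child_mem := by
    rintro x s ⟨_ | ⟨x, t⟩, hy, e⟩ a ha <;>
      simp only [Node.map, Node.or.injEq, reduceCtorEq] at e
    obtain ⟨rfl, rfl⟩ := e
    obtain ⟨b, hb, rfl⟩ := Finset.mem_image.1 ha
    exact ⟨_, h.child_mem x t hy b hb, rfl⟩
  mem_of_child := by
    rintro x s a ⟨(_ | ⟨x, t, b⟩) | _, hy, e⟩ <;>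
      simp only [Node.map, AndNode.map, Node.and.injEq, AndNode.child.injEq, reduceCtorEq] at e
    obtain ⟨rfl, rfl, rfl⟩ := e
    exact Finset.mem_image_of_mem _ (h.mem_of_child x t b hy)
  instance_of_or := by
    rintro x s ⟨_ | ⟨x, t⟩, hy, e⟩ <;>
      simp only [Node.map, Node.or.injEq, reduceCtorEq] at e
    obtain ⟨rfl, rfl⟩ := e
    obtain ⟨C, hC, τ, h1, rfl⟩ := h.instance_of_or x t hy
    exact ⟨C, hC, τ.comp σ, by rw [← Atom.subst_comp, h1, AndNode.label_map],
      C.bodySet_comp τ σ⟩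

/-- The or-node below `x` with the children `s`, together with these children. -/
def expansion {X : Type*} (x : AndNode X) (s : Finset X) : Set (Node X) :=
  {y | y = Node.or x s ∨ ∃ b ∈ s, y = Node.and (.child x s b)}

theorem expansion_finite {X : Type*} (x : AndNode X) (s : Finset X) : (expansion x s).Finite := by
  refine ((Set.finite_singleton (Node.or x s)).union
    (s.finite_toSet.image fun b => Node.and (.child x s b))).subset ?_
  rintro y (rfl | ⟨b, hb, rfl⟩)
  · exact Or.inl rfl
  · exact Or.inr ⟨b, hb, rfl⟩

theorem image_expansion {X Y : Type*} [DecidableEq Y] (f : X → Y) (x : AndNode X) (s : Finset X) :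
    Node.map f '' expansion x s = expansion (x.map f) (s.image f) := by
  ext y
  constructor
  · rintro ⟨_, rfl | ⟨b, hb, rfl⟩, rfl⟩
    · left; simp only [Node.map]; congr!
    · refine Or.inr ⟨f b, Finset.mem_image_of_mem f hb, ?_⟩
      simp only [Node.map, AndNode.map]; congr!
  · rintro (rfl | ⟨b, hb, rfl⟩)
    · refine ⟨_, Or.inl rfl, ?_⟩
      simp only [Node.map]; congr!
    · obtain ⟨a, ha, rfl⟩ := Finset.mem_image.1 hb
      refine ⟨_, Or.inr ⟨a, ha, rfl⟩, ?_⟩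
      simp only [Node.map, AndNode.map]; congr!

theorem IsResolutionTree.union_expansion {P : Program L} {A : Atom L ℕ}
    {S : Set (Node (Atom L ℕ))} (h : IsResolutionTree P A S) {x : AndNode (Atom L ℕ)}
    (hx : Node.and x ∈ S) {C : Clause L} (hC : C ∈ P) {τ : Subst L}
    (hτ : C.head.subst τ = x.label) :
    IsResolutionTree P A (S ∪ expansion x (C.bodySet τ)) where
  root_mem a := by simp [expansion, h.root_mem]
  parent_mem := by
    rintro y (hy | rfl | ⟨b, hb, rfl⟩) z hz
    · exact Or.inl (h.parent_mem y hy z hz)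
    · simp only [Node.parent, Option.some.injEq] at hz
      exact Or.inl (hz ▸ hx)
    · simp only [Node.parent, Option.some.injEq] at hz
      exact Or.inr (Or.inl hz.symm)
  child_mem := by
    rintro y s (hy | hy | ⟨b, hb, hy⟩) a ha
    · exact Or.inl (h.child_mem y s hy a ha)
    · simp only [Node.or.injEq] at hy
      obtain ⟨rfl, rfl⟩ := hy
      exact Or.inr (Or.inr ⟨a, ha, rfl⟩)
    · cases hy
  mem_of_child := by
    rintro y s a (hy | hy | ⟨b, hb, hy⟩)
    · exact h.mem_of_child y s a hy
    · cases hy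
    · simp only [Node.and.injEq, AndNode.child.injEq] at hy
      obtain ⟨rfl, rfl, rfl⟩ := hy
      exact hb
  instance_of_or := by
    rintro y s (hy | hy | ⟨b, hb, hy⟩)
    · exact h.instance_of_or y s hy
    · simp only [Node.or.injEq] at hy
      obtain ⟨rfl, rfl⟩ := hy
      exact ⟨C, hC, τ, hτ, rfl⟩
    · cases hy

/-! ### The trees generated by a derivation -/

namespace Derivation

variable {P : Program L} {G : Atom L ℕ} (D : Derivation P G)

theorem tree_succ {k : ℕ} {x : AndNode (Atom L ℕ)} (hx : (D.leaves k)[D.pos k]? = some x) :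
    D.tree (k + 1) = Node.map (fun B => B.subst (D.mgu k)) '' D.tree k ∪
      expansion (x.map fun B => B.subst (D.mgu k)) ((D.clause k).bodySet (D.mgu k)) := by
  simp [Derivation.tree, hx, expansion]

theorem leaves_succ {k : ℕ} {x : AndNode (Atom L ℕ)} (hx : (D.leaves k)[D.pos k]? = some x) :
    D.leaves (k + 1) =
      ((D.leaves k).take (D.pos k)).map (AndNode.map fun B => B.subst (D.mgu k)) ++
      (D.clause k).body.map (fun B => .child (x.map fun B => B.subst (D.mgu k))
        ((D.clause k).bodySet (D.mgu k)) (B.subst (D.mgu k))) ++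
      ((D.leaves k).drop (D.pos k + 1)).map (AndNode.map fun B => B.subst (D.mgu k)) := by
  simp [Derivation.leaves, hx]

theorem exists_leaf_of_goal {D : Derivation P G} {i : ℕ} (hi : (i : ℕ∞) < D.length)
    (hg : D.goal i = (D.leaves i).map AndNode.label) :
    ∃ x, (D.leaves i)[D.pos i]? = some x ∧
      x.label.subst (D.mgu i) = (D.clause i).head.subst (D.mgu i) := by
  obtain ⟨A, hA, hθ, -⟩ := D.step i hi
  rw [hg, List.getElem?_map, Option.map_eq_some_iff] at hA
  obtain ⟨x, hx, rfl⟩ := hA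
  exact ⟨x, hx, isUnifier_pair.1 hθ.1⟩

theorem goal_eq_map_label : ∀ {i : ℕ}, (i : ℕ∞) ≤ D.length →
    D.goal i = (D.leaves i).map AndNode.label
  | 0, _ => by simp [D.goal_zero, Derivation.leaves, AndNode.label]
  | i + 1, hi => by
    have hi' : (i : ℕ∞) < D.length := lt_of_lt_of_le (by exact_mod_cast i.lt_succ_self) hi
    have ih := goal_eq_map_label hi'.le
    obtain ⟨x, hx, -⟩ := exists_leaf_of_goal hi' ih
    obtain ⟨A, -, -, h⟩ := D.step i hi'
    rw [h, D.leaves_succ hx, ih]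
    simp [List.map_take, List.map_drop, Function.comp_def]

/-- Every step of a derivation resolves the label of a leaf. -/
theorem exists_leaf {i : ℕ} (hi : (i : ℕ∞) < D.length) :
    ∃ x, (D.leaves i)[D.pos i]? = some x ∧
      x.label.subst (D.mgu i) = (D.clause i).head.subst (D.mgu i) :=
  exists_leaf_of_goal hi (D.goal_eq_map_label hi.le)

theorem mem_tree_of_mem_leaves : ∀ {i : ℕ}, (i : ℕ∞) ≤ D.length →
    ∀ x ∈ D.leaves i, Node.and x ∈ D.tree i
  | 0, _ => by simp [Derivation.leaves, Derivation.tree]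
  | i + 1, hi => by
    have hi' : (i : ℕ∞) < D.length := lt_of_lt_of_le (by exact_mod_cast i.lt_succ_self) hi
    have ih := mem_tree_of_mem_leaves hi'.le
    obtain ⟨x, hx, -⟩ := D.exists_leaf hi'
    rw [D.leaves_succ hx, D.tree_succ hx]
    intro y hy
    simp only [List.mem_append, List.mem_map] at hy
    rcases hy with (⟨z, hz, rfl⟩ | ⟨B, hB, rfl⟩) | ⟨z, hz, rfl⟩
    · exact Or.inl ⟨_, ih z (List.mem_of_mem_take hz), rfl⟩
    · exact Or.inr (Or.inr ⟨_, Clause.mem_bodySet.2 ⟨B, hB, rfl⟩, rfl⟩)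
    · exact Or.inl ⟨_, ih z (List.mem_of_mem_drop hz), rfl⟩

theorem tree_finite : ∀ {i : ℕ}, (i : ℕ∞) ≤ D.length → (D.tree i).Finite
  | 0, _ => Set.finite_singleton _
  | i + 1, hi => by
    have hi' : (i : ℕ∞) < D.length := lt_of_lt_of_le (by exact_mod_cast i.lt_succ_self) hi
    obtain ⟨x, hx, -⟩ := D.exists_leaf hi'
    rw [D.tree_succ hx]
    exact ((tree_finite hi'.le).image _).union (expansion_finite _ _)

theorem isResolutionTree : ∀ {i : ℕ}, (i : ℕ∞) ≤ D.length →
    IsResolutionTree P (G.subst (D.answer i)) (D.tree i)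
  | 0, _ => by
    change IsResolutionTree P (G.subst Term.var) {_}
    rw [Atom.subst_var]
    exact isResolutionTree_root P G
  | i + 1, hi => by
    have hi' : (i : ℕ∞) < D.length := lt_of_lt_of_le (by exact_mod_cast i.lt_succ_self) hi
    obtain ⟨x, hx, hl⟩ := D.exists_leaf hi'
    obtain ⟨C, hC, hv⟩ := D.variant i hi'
    obtain ⟨τ, h1, h2⟩ := hv.exists_instance (D.mgu i)
    have hA : G.subst (D.answer (i + 1)) = (G.subst (D.answer i)).subst (D.mgu i) :=
      (Atom.subst_comp _ _ _).symm
    rw [D.tree_succ hx, ← h2, hA]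
    refine ((isResolutionTree hi'.le).image (D.mgu i)).union_expansion
      ⟨_, D.mem_tree_of_mem_leaves hi'.le x (List.mem_of_getElem? hx), rfl⟩ hC ?_
    rw [h1, AndNode.label_map, hl]

/-- An and-node whose atom no longer stands in the goal has been resolved. -/
theorem mem_leaves_or_exists_child : ∀ {i : ℕ}, (i : ℕ∞) ≤ D.length →
    ∀ x, Node.and x ∈ D.tree i → x ∈ D.leaves i ∨ ∃ s, Node.or x s ∈ D.tree i
  | 0, _ => by
    intro x hx
    simp only [Derivation.tree, Set.mem_singleton_iff, Node.and.injEq] at hx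
    simp [Derivation.leaves, hx]
  | i + 1, hi => by
    have hi' : (i : ℕ∞) < D.length := lt_of_lt_of_le (by exact_mod_cast i.lt_succ_self) hi
    have ih := mem_leaves_or_exists_child hi'.le
    obtain ⟨x, hx, -⟩ := D.exists_leaf hi'
    rw [D.leaves_succ hx, D.tree_succ hx]
    rintro y (⟨z | _, hz, e⟩ | hy | ⟨b, hb, hy⟩)
    · simp only [Node.map, Node.and.injEq] at e
      subst e
      rcases ih z hz with hz | ⟨s, hs⟩
      · obtain ⟨j, hj, rfl⟩ := List.mem_iff_getElem.1 hz
        rcases lt_trichotomy j (D.pos i) with h | h | h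
        · left
          refine List.mem_append_left _ (List.mem_append_left _ (List.mem_map_of_mem ?_))
          exact List.mem_take_iff_getElem.2 ⟨j, by omega, rfl⟩
        · right
          subst h
          rw [List.getElem?_eq_getElem hj, Option.some.injEq] at hx
          exact ⟨_, Or.inr (Or.inl (by rw [hx]))⟩
        · left
          refine List.mem_append_right _ (List.mem_map_of_mem ?_)
          refine List.mem_drop_iff_getElem.2 ⟨j - (D.pos i + 1), by omega, ?_⟩
          congr 1
          omega
      · exact Or.inr ⟨_, Or.inl ⟨_, hs, rfl⟩⟩
    · simp [Node.map] at e
    · cases hy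
    · simp only [Node.and.injEq] at hy
      subst hy
      obtain ⟨B, hB, rfl⟩ := Clause.mem_bodySet.1 hb
      exact Or.inl (List.mem_append_left _ (List.mem_append_right _ (List.mem_map.2 ⟨B, hB, rfl⟩)))

end Derivation

/-! ### Prunings -/

/-- The nodes of `S` all of whose or-ancestors are the ones selected by `c`. -/
inductive PruneMem {X : Type w} (S : Set (Node X)) (c : AndNode X → Finset X) : Node X → Prop
  | root (a : X) : Node.and (.root a) ∈ S → PruneMem S c (Node.and (.root a))
  | or (x : AndNode X) : PruneMem S c (Node.and x) → Node.or x (c x) ∈ S →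
      PruneMem S c (Node.or x (c x))
  | child (x : AndNode X) (s : Finset X) (a : X) : PruneMem S c (Node.or x s) →
      Node.and (.child x s a) ∈ S → PruneMem S c (Node.and (.child x s a))

theorem Node.parent_eq_some_and {X : Type*} {y : Node X} {x : AndNode X} :
    y.parent = some (Node.and x) ↔ ∃ s, y = Node.or x s := by
  rcases y with (_ | _) | _ <;> simp [Node.parent]

theorem Node.parent_eq_some_or {X : Type*} {y : Node X} {x : AndNode X} {s : Finset X} :
    y.parent = some (Node.or x s) ↔ ∃ a, y = Node.and (.child x s a) := by
  rcases y with (_ | _) | _ <;> simp [Node.parent]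

theorem exists_isPruning {X : Type*} (S : Set (Node X)) : ∃ T, IsPruning S T := by
  classical
  let c : AndNode X → Finset X := fun x => if h : ∃ s, Node.or x s ∈ S then h.choose else ∅
  have hc : ∀ x s, Node.or x s ∈ S → Node.or x (c x) ∈ S := fun x s h => by
    have h' : ∃ s, Node.or x s ∈ S := ⟨s, h⟩
    simp only [c, dif_pos h']
    exact h'.choose_spec
  refine ⟨{y | PruneMem S c y}, ?_, ?_, ?_, ?_, ?_⟩
  · rintro y (⟨_, h⟩ | ⟨_, _, h⟩ | ⟨_, _, _, _, h⟩) <;> exact h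
  · rintro ((a | _) | _) hy h
    · exact .root a hy
    · simp [Node.parent] at h
    · simp [Node.parent] at h
  · rintro y (⟨_, h⟩ | ⟨_, h', h⟩ | ⟨_, _, _, h', h⟩) z hz <;>
      simp only [Node.parent, Option.some.injEq, reduceCtorEq] at hz
    · exact hz ▸ h'
    · exact hz ▸ h'
  · rintro x hx ⟨y, hy, hyx⟩
    obtain ⟨s, rfl⟩ := Node.parent_eq_some_and.1 hyx
    refine ⟨Node.or x (c x), ⟨.or x hx (hc x s hy), rfl⟩, ?_⟩
    rintro z ⟨hz, hzx⟩
    obtain ⟨t, rfl⟩ := Node.parent_eq_some_and.1 hzx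
    cases hz
    rfl
  · rintro x s hx y hy hyx
    obtain ⟨a, rfl⟩ := Node.parent_eq_some_or.1 hyx
    exact .child x s a hx hy

/-- `hch` says that `S` itself contains all children of its or-nodes, so that pruning, which only
selects among the children of and-nodes, leads to a derivation subtree. -/
theorem IsPruning.isDerivationSubtree {X : Type*} {U : AndOrTree X} {S T : Set (Node X)}
    (hT : IsPruning S T) (hS : U.IsSubtree S)
    (hch : ∀ x s, Node.or x s ∈ S → ∀ a ∈ s, Node.and (.child x s a) ∈ S) :
    U.IsDerivationSubtree T := by
  obtain ⟨h1, h2, h3, h4, h5⟩ := hT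
  refine ⟨⟨h1.trans hS.1, h2 _ hS.2.1 rfl, h3⟩, ?_, ?_⟩
  · intro x hx y hy z hz hyx hzx
    exact (h4 x hx ⟨y, h1 hy, hyx⟩).unique ⟨hy, hyx⟩ ⟨hz, hzx⟩
  · intro x s hx y hy hyx
    obtain ⟨a, rfl⟩ := Node.parent_eq_some_or.1 hyx
    exact h5 x s hx _ (hch x s (h1 hx) a ((U.child_mem x s a).1 hy).2) hyx

/-! ### Soundness -/

theorem Atom.toVar_injective (n : ℕ) :
    Function.Injective (Atom.toVar : Atom L (Fin n) → Atom L ℕ) := by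
  have key : ∀ t s : L.Term (Fin n), t.subst (fun i => Term.var (i : ℕ)) =
      s.subst (fun i => Term.var (i : ℕ)) → t = s := by
    intro t
    induction t with
    | var x =>
      rintro (y | _) h <;> simp only [Term.subst, Term.var.injEq, reduceCtorEq] at h
      rw [Fin.ext h]
    | func F ts ih =>
      rintro (y | @⟨l, F', ss⟩) h <;> simp only [Term.subst, Term.func.injEq, reduceCtorEq] at h
      obtain ⟨rfl, h1, h2⟩ := h
      obtain rfl := eq_of_heq h1
      congr 1
      funext i
      exact ih i _ (congrFun (eq_of_heq h2) i)
  rintro ⟨p, ts⟩ ⟨q, ss⟩ h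
  simp only [Atom.toVar, Atom.subst, Atom.mk.injEq] at h
  obtain ⟨rfl, h1, h2⟩ := h
  obtain rfl := eq_of_heq h1
  congr 1
  funext i
  exact key _ _ (congrFun (eq_of_heq h2) i)

/-- Nodes all of whose variables are below `n` come from nodes over `At(n)`. -/
theorem Node.BoundedBy.mem_range {n : ℕ} {y : Node (Atom L ℕ)} (hn : 0 < n) (h : y.BoundedBy n) :
    y ∈ Set.range (Node.map (Atom.toVar : Atom L (Fin n) → Atom L ℕ)) := by
  -- The value of `r` from `n` on does not matter.
  let r : ℕ → L.Term (Fin n) := fun x => if hx : x < n then .var ⟨x, hx⟩ else .var ⟨0, hn⟩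
  refine ⟨y.map fun B => B.subst r, ?_⟩
  have e := h (fun x => (r x).subst fun i => Term.var (i : ℕ)) Term.var fun x hx => by
    simp [r, hx, Term.subst]
  simp only [Atom.subst_var, Node.map_id] at e
  rw [Node.map_map]
  simpa only [Atom.toVar, Atom.subst_subst] using e

open Classical in
theorem IsResolutionTree.isSubtree [Countable (Σ l, L.Functions l)] {P : Program L} {n : ℕ}
    {A : Atom L (Fin n)} {S : Set (Node (Atom L (Fin n)))}
    (h : IsResolutionTree P A.toVar (Node.map Atom.toVar '' S)) :
    (P.coalgebra.bar n A).IsSubtree S := by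
  have inj := Node.map_injective (Atom.toVar_injective (L := L) n)
  have mem : ∀ y, Node.map Atom.toVar y ∈ Node.map Atom.toVar '' S → y ∈ S :=
    fun y ⟨z, hz, e⟩ => inj e ▸ hz
  have hp : ∀ y ∈ S, ∀ z, y.parent = some z → z ∈ S := fun y hy z hz =>
    mem z (h.parent_mem _ ⟨y, hy, rfl⟩ _ (by rw [Node.parent_map, hz]; rfl))
  have hor : ∀ x s, UnfoldMem (P.coalgebra.app n) A (Node.and x) → Node.or x s ∈ S →
      UnfoldMem (P.coalgebra.app n) A (Node.or x s) := fun x s hx hs => by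
    refine .or x s hx ?_
    obtain ⟨C, hC, τ, h1, h2⟩ := h.instance_of_or _ _ ⟨_, hs, rfl⟩
    exact ⟨C, hC, τ, by rw [h1, AndNode.label_map], h2.symm⟩
  have hand : ∀ x, Node.and x ∈ S → UnfoldMem (P.coalgebra.app n) A (Node.and x) := by
    intro x
    induction x with
    | root a =>
      intro hx
      have := (h.root_mem a.toVar).1 ⟨_, hx, rfl⟩
      rw [Atom.toVar_injective n this]
      exact .root
    | child x s a ih =>
      intro hx
      have hs := hp _ hx _ rfl
      refine .and x s a (hor x s (ih (hp _ hs _ rfl)) hs) ?_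
      have := h.mem_of_child _ _ _ ⟨_, hx, rfl⟩
      obtain ⟨b, hb, e⟩ := Finset.mem_image.1 this
      exact Atom.toVar_injective n e ▸ hb
  refine ⟨?_, mem _ ((h.root_mem A.toVar).2 rfl), hp⟩
  rintro (x | ⟨x, s⟩) hy
  · exact hand x hy
  · exact hor x s (hand x (hp _ hy _ rfl)) hy

open Classical in
theorem Derivation.soundness [Countable (Σ l, L.Functions l)] {P : Program L} {G : Atom L ℕ}
    (D : Derivation P G) (k : ℕ) (hk : (k : ℕ∞) ≤ D.length) :
    ∃ (n : ℕ) (A : Atom L (Fin n)), A.toVar = G.subst (D.answer k) ∧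
      ∃ S : Set (Node (Atom L (Fin n))), Node.map Atom.toVar '' S = D.tree k ∧
        S.Finite ∧ (P.coalgebra.bar n A).IsSubtree S ∧ (∃ T, IsPruning S T) ∧
        ∀ T, IsPruning S T → (P.coalgebra.bar n A).IsDerivationSubtree T := by
  obtain ⟨N, hN⟩ := exists_boundedBy_of_finite (D.tree_finite hk)
  have hR := D.isResolutionTree hk
  have hrange : ∀ y ∈ D.tree k,
      y ∈ Set.range (Node.map (Atom.toVar : Atom L (Fin (N + 1)) → Atom L ℕ)) :=
    fun y hy => ((hN y hy).mono N.le_succ).mem_range N.succ_pos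
  have inj := Node.map_injective (Atom.toVar_injective (L := L) (N + 1))
  obtain ⟨(⟨A⟩ | _) | _, hA⟩ := hrange _ ((hR.root_mem _).2 rfl) <;>
    simp only [Node.map, AndNode.map, Node.and.injEq, AndNode.root.injEq, reduceCtorEq] at hA
  have hS : Node.map Atom.toVar '' (Node.map Atom.toVar ⁻¹' D.tree k) = D.tree k :=
    Set.image_preimage_eq_of_subset hrange
  have hsub : (P.coalgebra.bar (N + 1) A).IsSubtree (Node.map Atom.toVar ⁻¹' D.tree k) :=
    IsResolutionTree.isSubtree (by rw [hS, hA]; exact hR)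
  refine ⟨N + 1, A, hA, _, hS, (D.tree_finite hk).preimage inj.injOn, hsub, exists_isPruning _,
    fun T hT => hT.isDerivationSubtree hsub fun x s hx a ha => ?_⟩
  exact hR.child_mem _ _ hx _ (Finset.mem_image_of_mem _ ha)

/-! ### Fresh variants of clauses -/

theorem Atom.mem_vars_rename {A : Atom L ℕ} {π : ℕ → ℕ} {x : ℕ}
    (hx : x ∈ (A.subst fun y => (Term.var (π y) : L.Term ℕ)).vars) : ∃ y ∈ A.vars, x = π y := by
  obtain ⟨i, hi⟩ := hx
  obtain ⟨y, hy, hxy⟩ := (mem_varFinset_subst _ _ _).1 hi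
  exact ⟨y, ⟨i, hy⟩, by simpa [Term.varFinset] using hxy⟩

theorem Atom.rename_injective (π : Equiv.Perm ℕ) :
    Function.Injective fun A : Atom L ℕ => A.subst fun y => (Term.var (π y) : L.Term ℕ) := by
  refine Function.LeftInverse.injective
    (g := fun A => A.subst fun y => Term.var (π.symm y)) fun A => ?_
  simp only [Atom.subst_subst, Term.subst, Equiv.symm_apply_apply]
  exact A.subst_var

/-- The permutation exchanging the first `M` natural numbers with the next `M`. -/
def blockSwap (M : ℕ) : Equiv.Perm ℕ :=
  Function.Involutive.toPerm
    (fun x => if x < M then x + M else if x < 2 * M then x - M else x) fun x => by grind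

theorem Clause.exists_fresh_variant (C : Clause L) (N : ℕ) :
    ∃ C' : Clause L, C.IsVariant C' ∧ (∀ x ∈ C'.vars, N ≤ x) ∧
      C'.body.length = C.body.length ∧ ∀ τ : Subst L, ∃ τ' : Subst L,
        C'.head.subst τ' = C.head.subst τ ∧ C'.bodySet τ' = C.bodySet τ := by
  obtain ⟨K, hK⟩ := exists_lt_of_finite C.vars_finite
  let π := blockSwap (max N K)
  have hπ : ∀ x ∈ C.vars, N ≤ π x := fun x hx => by
    have : x < max N K := (hK x hx).trans_le (le_max_right _ _)
    have h : π x = x + max N K := if_pos this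
    rw [h]
    exact (le_max_left N K).trans (Nat.le_add_left _ _)
  refine ⟨⟨C.head.subst fun x => .var (π x), C.body.map fun B => B.subst fun x => .var (π x),
    C.nodup.map (Atom.rename_injective π)⟩, ⟨π, rfl, rfl⟩, ?_, by simp, fun τ => ?_⟩
  · rintro x (hx | ⟨B', hB', hx⟩)
    · obtain ⟨y, hy, rfl⟩ := Atom.mem_vars_rename hx
      exact hπ y (Or.inl hy)
    · obtain ⟨B, hB, rfl⟩ := List.mem_map.1 hB'
      obtain ⟨y, hy, rfl⟩ := Atom.mem_vars_rename hx
      exact hπ y (Or.inr ⟨B, hB, hy⟩)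
  · refine ⟨fun x => τ (π.symm x), ?_, ?_⟩
    · simp [Atom.subst_subst, Term.subst]
    · ext A
      simp [Clause.mem_bodySet, Atom.subst_subst, Term.subst]

/-! ### Extending finite derivations -/

namespace Derivation

variable {P : Program L} {G : Atom L ℕ}

/-- The first `k` steps of `D` and `E` are the same. -/
structure Agree (D E : Derivation P G) (k : ℕ) : Prop where
  goal : ∀ i ≤ k, E.goal i = D.goal i
  pos : ∀ i < k, E.pos i = D.pos i
  clause : ∀ i < k, E.clause i = D.clause i
  mgu : ∀ i < k, E.mgu i = D.mgu i

theorem Agree.refl (D : Derivation P G) (k : ℕ) : Agree D D k :=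
  ⟨fun _ _ => rfl, fun _ _ => rfl, fun _ _ => rfl, fun _ _ => rfl⟩

theorem Agree.trans {D E F : Derivation P G} {k l : ℕ} (h : Agree D E k) (h' : Agree E F l)
    (hkl : k ≤ l) : Agree D F k where
  goal i hi := (h'.goal i (hi.trans hkl)).trans (h.goal i hi)
  pos i hi := (h'.pos i (hi.trans_le hkl)).trans (h.pos i hi)
  clause i hi := (h'.clause i (hi.trans_le hkl)).trans (h.clause i hi)
  mgu i hi := (h'.mgu i (hi.trans_le hkl)).trans (h.mgu i hi)

theorem Agree.leaves_eq {D E : Derivation P G} {k : ℕ} (h : Agree D E k) :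
    ∀ {i : ℕ}, i ≤ k → E.leaves i = D.leaves i
  | 0, _ => rfl
  | i + 1, hi => by
    simp only [Derivation.leaves, h.leaves_eq (Nat.le_of_succ_le hi), h.pos i hi, h.clause i hi,
      h.mgu i hi]

theorem Agree.tree_eq {D E : Derivation P G} {k : ℕ} (h : Agree D E k) :
    ∀ {i : ℕ}, i ≤ k → E.tree i = D.tree i
  | 0, _ => rfl
  | i + 1, hi => by
    simp only [Derivation.tree, h.tree_eq (Nat.le_of_succ_le hi),
      h.leaves_eq (Nat.le_of_succ_le hi), h.pos i hi, h.clause i hi, h.mgu i hi]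

/-- The derivation without steps. As its length is `0`, the values of `pos`, `clause` and `mgu` are
irrelevant. -/
def nil (P : Program L) (G : Atom L ℕ) : Derivation P G where
  length := 0
  goal _ := [G]
  pos _ := 0
  clause _ := ⟨G, [], List.nodup_nil⟩
  mgu _ := Term.var
  goal_zero := rfl
  variant i hi := absurd hi (by simp)
  apart i hi := absurd hi (by simp)
  step i hi := absurd hi (by simp)

/-- A derivation of length `k` can be prolonged by a step that resolves a given leaf. -/
theorem exists_extension (D : Derivation P G) {k m : ℕ} (hk : D.length = k)
    {x : AndNode (Atom L ℕ)} (hx : (D.leaves k)[m]? = some x) {C C' : Clause L} (hC : C ∈ P)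
    (hv : C.IsVariant C')
    (hap : ∀ x ∈ C'.vars, (∀ j ≤ k, ∀ B ∈ D.goal j, x ∉ B.vars) ∧
      ∀ j < k, x ∉ (D.clause j).vars ∧ x ∉ (D.mgu j).vars)
    {θ : Subst L} (hθ : IsMGU {x.label, C'.head} θ) :
    ∃ E : Derivation P G, E.length = (k + 1 : ℕ) ∧ Agree D E k ∧ E.pos k = m ∧
      E.clause k = C' ∧ E.mgu k = θ := by
  have hlt : ∀ i : ℕ, i < k → (i : ℕ∞) < D.length := fun i hi => by
    rw [hk]; exact_mod_cast hi
  have hle : ∀ i : ℕ, (i : ℕ∞) < (k + 1 : ℕ) → i < k ∨ i = k := fun i hi => by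
    have : i < k + 1 := by exact_mod_cast hi
    omega
  refine ⟨{
    length := (k + 1 : ℕ)
    goal := fun i => if i ≤ k then D.goal i else
      ((D.goal k).take m ++ C'.body ++ (D.goal k).drop (m + 1)).map fun B => B.subst θ
    pos := fun i => if i < k then D.pos i else m
    clause := fun i => if i < k then D.clause i else C'
    mgu := fun i => if i < k then D.mgu i else θ
    goal_zero := by simp [D.goal_zero]
    variant := ?_
    apart := ?_
    step := ?_ }, rfl, ⟨?_, ?_, ?_, ?_⟩, ?_, ?_, ?_⟩
  · intro i hi
    rcases hle i hi with h | rfl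
    · simpa [h] using D.variant i (hlt i h)
    · simpa using ⟨C, hC, hv⟩
  · intro i hi x hx
    have hi' : i ≤ k := by rcases hle i hi with h | h <;> omega
    have key : (∀ j ≤ i, ∀ B ∈ D.goal j, x ∉ B.vars) ∧
        ∀ j < i, x ∉ (D.clause j).vars ∧ x ∉ (D.mgu j).vars := by
      rcases hle i hi with h | rfl
      · rw [if_pos h] at hx
        exact D.apart i (hlt i h) x hx
      · rw [if_neg (lt_irrefl _)] at hx
        exact hap x hx
    refine ⟨fun j hj => ?_, fun j hj => ?_⟩
    · rw [if_pos (hj.trans hi')]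
      exact key.1 j hj
    · rw [if_pos (hj.trans_le hi'), if_pos (hj.trans_le hi')]
      exact key.2 j hj
  · intro i hi
    rcases hle i hi with h | rfl
    · simpa [h, h.le, Nat.succ_le_of_lt h] using D.step i (hlt i h)
    · have hA : (D.goal i)[m]? = some x.label := by
        rw [D.goal_eq_map_label hk.ge, List.getElem?_map, hx]
        rfl
      simpa using ⟨x.label, hA, hθ, by simp⟩
  · intro i hi; simp [hi]
  · intro i hi; simp [hi]
  · intro i hi; simp [hi]
  · intro i hi; simp [hi]
  · simp
  · simp
  · simp

/-! ### Lifting -/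

/-- All unifiers used in the first `k` steps of `D` involve finitely many variables only, so
that there are fresh variables for a further step. -/
def FinitelySupported (D : Derivation P G) (k : ℕ) : Prop :=
  ∀ j < k, (D.mgu j).vars.Finite

theorem FinitelySupported.exists_fresh {D : Derivation P G} {k : ℕ} (h : D.FinitelySupported k) :
    ∃ N, ∀ x, N ≤ x → (∀ j ≤ k, ∀ B ∈ D.goal j, x ∉ B.vars) ∧
      ∀ j < k, x ∉ (D.clause j).vars ∧ x ∉ (D.mgu j).vars := by
  have h1 : (⋃ j ∈ Set.Iic k, ⋃ B ∈ {B | B ∈ D.goal j}, B.vars).Finite :=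
    (Set.finite_Iic k).biUnion fun j _ =>
      (List.finite_toSet (D.goal j)).biUnion fun B _ => B.vars_finite
  have h2 : (⋃ j ∈ Set.Iio k, ((D.clause j).vars ∪ (D.mgu j).vars)).Finite :=
    (Set.finite_Iio k).biUnion fun j hj => (D.clause j).vars_finite.union (h j hj)
  obtain ⟨N, hN⟩ := exists_lt_of_finite (h1.union h2)
  refine ⟨N, fun x hx => ⟨fun j hj B hB hxB => ?_, fun j hj => ⟨fun hxc => ?_, fun hxc => ?_⟩⟩⟩
  · refine absurd (hN x (Or.inl ?_)) hx.not_gt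
    simp only [Set.mem_iUnion]
    exact ⟨j, hj, B, hB, hxB⟩
  · exact absurd (hN x (Or.inr (Set.mem_biUnion (Set.mem_Iio.2 hj) (Or.inl hxc)))) hx.not_gt
  · exact absurd (hN x (Or.inr (Set.mem_biUnion (Set.mem_Iio.2 hj) (Or.inr hxc)))) hx.not_gt

/-- A weight of lists of leaves, which decreases when a leaf of depth less than `H` is replaced by
at most `M` leaves one level below it. -/
def leafWeight {X : Type*} (M H : ℕ) (l : List (AndNode X)) : ℕ :=
  (l.map fun x => (M + 1) ^ (H - x.depth)).sum

/-- One step of the lifting of the tree `T` to a derivation: if the instance `xσ` of a leaf `x` of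
the tree generated so far is resolved in `T`, then `x` can be resolved such that the new tree still
has an instance inside `T`. -/
theorem exists_lift_step {D : Derivation P G} {k m : ℕ} (hk : D.length = k)
    (hfin : D.FinitelySupported k) {A : Atom L ℕ} {T : Set (Node (Atom L ℕ))}
    (hT : IsResolutionTree P A T) {σ : Subst L}
    (hσ : Node.map (fun B => B.subst σ) '' D.tree k ⊆ T) {x : AndNode (Atom L ℕ)}
    (hx : (D.leaves k)[m]? = some x) {s : Finset (Atom L ℕ)}
    (hs : Node.or (x.map fun B => B.subst σ) s ∈ T) {M H : ℕ}
    (hM : ∀ C ∈ P, C.body.length ≤ M) (hH : ∀ x, Node.and x ∈ T → x.depth < H) :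
    ∃ (E : Derivation P G) (γ : Subst L), E.length = (k + 1 : ℕ) ∧ Agree D E k ∧
      E.FinitelySupported (k + 1) ∧ Node.map (fun B => B.subst γ) '' E.tree (k + 1) ⊆ T ∧
      leafWeight M H (E.leaves (k + 1)) < leafWeight M H (D.leaves k) := by
  classical
  obtain ⟨C, hC, τ, hτ, rfl⟩ := hT.instance_of_or _ _ hs
  obtain ⟨N₁, hN₁⟩ := exists_boundedBy_of_finite (D.tree_finite hk.ge)
  obtain ⟨N₂, hN₂⟩ := hfin.exists_fresh
  obtain ⟨C', hv, hC', hlen, hinst⟩ := C.exists_fresh_variant (max N₁ N₂)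
  obtain ⟨τ', h1, h2⟩ := hinst τ
  -- Since `C'` is fresh, `σ` and `τ'` have a common extension; it unifies the two atoms.
  let ρ : Subst L := fun y => if y < N₁ then σ y else τ' y
  have hρσ : ∀ y ∈ D.tree k,
      y.map (fun B => B.subst ρ) = y.map fun B => B.subst σ := fun y hy =>
    hN₁ y hy ρ σ fun z hz => if_pos hz
  have hρτ : ∀ z ∈ C'.vars, ρ z = τ' z := fun z hz =>
    if_neg ((le_max_left _ _).trans (hC' z hz)).not_gt
  have hxmem := D.mem_tree_of_mem_leaves hk.ge x (List.mem_of_getElem? hx)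
  have hxρ : x.map (fun B => B.subst ρ) = x.map fun B => B.subst σ := by
    simpa [Node.map] using hρσ _ hxmem
  have huni : x.label.subst ρ = C'.head.subst ρ := by
    have := congrArg AndNode.label hxρ
    rw [AndNode.label_map, AndNode.label_map] at this
    rw [this, Clause.head_subst_congr hρτ, h1, hτ, AndNode.label_map]
  obtain ⟨θ, hθ, hθfin⟩ := exists_isMGU huni
  obtain ⟨γ, hγ⟩ := hθ.2 ρ (isUnifier_pair.2 huni)
  obtain ⟨E, hE, hDE, hpos, hcl, hmgu⟩ := D.exists_extension hk hx hC hv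
    (fun z hz => hN₂ z ((le_max_right _ _).trans (hC' z hz))) hθ
  have hx' : (E.leaves k)[E.pos k]? = some x := by rw [hpos, hDE.leaves_eq le_rfl, hx]
  refine ⟨E, γ, hE, hDE, ?_, ?_, ?_⟩
  · intro j hj
    rcases Nat.lt_succ_iff_lt_or_eq.1 hj with hj | rfl
    · rw [hDE.mgu j hj]; exact hfin j hj
    · rw [hmgu]; exact Subst.vars_finite hθfin
  · rw [E.tree_succ hx', hmgu, hcl, hDE.tree_eq le_rfl, Set.image_union,
      Node.image_map_subst_comp, image_expansion, AndNode.map_subst_comp, ← hγ]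
    have e : (C'.bodySet θ).image (fun B => B.subst γ) = C.bodySet τ := by
      rw [← h2, ← Clause.bodySet_congr hρτ, hγ, Clause.bodySet_comp]
    rw [e, hxρ]
    rintro y (⟨z, hz, rfl⟩ | rfl | ⟨b, hb, rfl⟩)
    · rw [hρσ z hz]
      exact hσ ⟨z, hz, rfl⟩
    · exact hs
    · exact hT.child_mem _ _ hs b hb
  · have hd : x.depth < H := by
      simpa using hH _ (hσ ⟨_, hxmem, rfl⟩)
    obtain ⟨hm, rfl⟩ := List.getElem?_eq_some_iff.1 hx
    have hsplit : D.leaves k =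
        (D.leaves k).take m ++ (D.leaves k)[m] :: (D.leaves k).drop (m + 1) := by
      rw [List.getElem_cons_drop, List.take_append_drop]
    have hbody : C'.body.length ≤ M := hlen ▸ hM C hC
    rw [E.leaves_succ hx', hpos, hcl, hmgu, hDE.leaves_eq le_rfl]
    generalize (D.leaves k)[m] = x at hd hsplit
    conv_rhs => rw [hsplit]
    have hpow : C'.body.length * (M + 1) ^ (H - (x.depth + 1)) < (M + 1) ^ (H - x.depth) := by
      obtain ⟨r, hr⟩ : ∃ r, H - x.depth = r + 1 := ⟨H - x.depth - 1, by omega⟩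
      have hr' : H - (x.depth + 1) = r := by omega
      rw [hr, hr', pow_succ, mul_comm]
      exact Nat.mul_lt_mul_of_pos_left (Nat.lt_succ_of_le hbody) (by positivity)
    simp only [leafWeight, List.map_append, List.map_map, List.sum_append, List.map_cons,
      List.sum_cons, Function.comp_def, AndNode.depth_map, AndNode.depth, List.map_const',
      List.sum_replicate, smul_eq_mul]
    omega

/-- If no leaf of the generated tree `S` has an instance resolved in `T`, then `Sσ` is all of `T`:
every other and-node of `S` has a child, whose instance is the only child in `T`. -/
theorem image_tree_eq_of_no_step {D : Derivation P G} {k : ℕ} (hk : (k : ℕ∞) ≤ D.length)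
    {A : Atom L ℕ} {T : Set (Node (Atom L ℕ))} (hT : IsResolutionTree P A T)
    (hT' : ∀ x s t, Node.or x s ∈ T → Node.or x t ∈ T → s = t) {σ : Subst L}
    (hσ : Node.map (fun B => B.subst σ) '' D.tree k ⊆ T)
    (hleaf : ∀ x ∈ D.leaves k, ∀ s, Node.or (x.map fun B => B.subst σ) s ∉ T) :
    Node.map (fun B => B.subst σ) '' D.tree k = T := by
  have hI := (D.isResolutionTree hk).image σ
  have hor : ∀ x s, Node.and x ∈ Node.map (fun B => B.subst σ) '' D.tree k → Node.or x s ∈ T →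
      Node.or x s ∈ Node.map (fun B => B.subst σ) '' D.tree k := by
    rintro x s ⟨y | _, hy, e⟩ hs <;> simp only [Node.map, Node.and.injEq, reduceCtorEq] at e
    subst e
    rcases D.mem_leaves_or_exists_child hk y hy with h | ⟨t, ht⟩
    · exact absurd hs (hleaf y h s)
    · have h := Set.mem_image_of_mem (Node.map fun B => B.subst σ) ht
      rw [hT' _ _ _ hs (hσ h)]
      exact h
  have hand : ∀ x, Node.and x ∈ T → Node.and x ∈ Node.map (fun B => B.subst σ) '' D.tree k := by
    intro x
    induction x with
    | root a =>
      intro hx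
      have h := (hI.root_mem _).2 rfl
      rwa [(hT.root_mem a).1 hx, ← (hT.root_mem _).1 (hσ h)]
    | child x s a ih =>
      intro hx
      have hs := hT.parent_mem _ hx _ rfl
      exact hI.child_mem _ _ (hor x s (ih (hT.parent_mem _ hs _ rfl)) hs) a
        (hT.mem_of_child _ _ _ hx)
  refine hσ.antisymm ?_
  rintro (x | ⟨x, s⟩) hy
  · exact hand x hy
  · exact hor x s (hand x (hT.parent_mem _ hy _ rfl)) hy

/-- A finite derivation whose tree has an instance inside `T` can be prolonged until the
tree has `T` itself as an instance. -/
theorem exists_lift {A : Atom L ℕ} {T : Set (Node (Atom L ℕ))} (hT : IsResolutionTree P A T)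
    (hT' : ∀ x s t, Node.or x s ∈ T → Node.or x t ∈ T → s = t) (hTfin : T.Finite)
    (D : Derivation P G) (k : ℕ) (σ : Subst L) (hk : D.length = k) (hfin : D.FinitelySupported k)
    (hσ : Node.map (fun B => B.subst σ) '' D.tree k ⊆ T) :
    ∃ (E : Derivation P G) (l : ℕ) (γ : Subst L), k ≤ l ∧ Agree D E k ∧ E.length = l ∧
      E.FinitelySupported l ∧ Node.map (fun B => B.subst γ) '' E.tree l = T := by
  obtain ⟨M, hM⟩ : ∃ M, ∀ C ∈ P, C.body.length ≤ M :=
    ⟨P.sup fun C => C.body.length, fun C hC => Finset.le_sup (f := fun C => C.body.length) hC⟩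
  obtain ⟨H, hH⟩ : ∃ H, ∀ x, Node.and x ∈ T → x.depth < H := by
    obtain ⟨H, hH⟩ := exists_lt_of_finite
      ((hTfin.preimage (f := Node.and) (by intro x _ y _ h; exact Node.and.inj h)).image
        AndNode.depth)
    exact ⟨H, fun x hx => hH _ ⟨x, hx, rfl⟩⟩
  induction hw : leafWeight M H (D.leaves k) using Nat.strong_induction_on
    generalizing D k σ with
  | _ w ih =>
  by_cases h : ∃ x ∈ D.leaves k, ∃ s, Node.or (x.map fun B => B.subst σ) s ∈ T
  · obtain ⟨x, hx, s, hs⟩ := h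
    obtain ⟨m, hm⟩ := List.mem_iff_getElem?.1 hx
    obtain ⟨E, γ, hE, hDE, hEfin, hγ, hlt⟩ := exists_lift_step hk hfin hT hσ hm hs hM hH
    obtain ⟨F, l, δ, hl, hEF, h'⟩ := ih _ (hw ▸ hlt) E (k + 1) γ hE hEfin hγ rfl
    exact ⟨F, l, δ, by omega, hDE.trans hEF (by omega), h'⟩
  · push Not at h
    exact ⟨D, k, σ, le_rfl, Agree.refl D k, hk, hfin, image_tree_eq_of_no_step hk.ge hT hT' hσ h⟩

/-! ### Limits of chains of derivations -/

theorem exists_limit_seq {α : Type*} (f : ℕ → ℕ → α) {k : ℕ → ℕ} (hk : Monotone k)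
    (h : ∀ n, ∀ i < k n, f (n + 1) i = f n i) : ∃ F : ℕ → α, ∀ n, ∀ i < k n, F i = f n i := by
  classical
  have key : ∀ m n, m ≤ n → ∀ i < k m, f n i = f m i := by
    intro m n hmn
    induction n, hmn using Nat.le_induction with
    | base => exact fun _ _ => rfl
    | succ n hmn ih => exact fun i hi => (h n i (hi.trans_le (hk hmn))).trans (ih i hi)
  refine ⟨fun i => if h : ∃ n, i < k n then f h.choose i else f 0 i, fun n i hi => ?_⟩
  have hex : ∃ n, i < k n := ⟨n, hi⟩
  simp only [dif_pos hex]
  rcases le_total n hex.choose with hle | hle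
  · exact key _ _ hle i hi
  · exact (key _ _ hle i hex.choose_spec).symm

/-- A chain of finite derivations, each prolonging the one before, has a limit, which is infinite if
the lengths are unbounded. -/
theorem exists_limit (D : ℕ → Derivation P G) {k : ℕ → ℕ} (hk : Monotone k)
    (hlen : ∀ n, (D n).length = k n) (h : ∀ n, Agree (D n) (D (n + 1)) (k n)) :
    ∃ E : Derivation P G, ∀ n, (k n : ℕ∞) ≤ E.length ∧ Agree (D n) E (k n) := by
  obtain ⟨goal, hgoal⟩ := exists_limit_seq (fun n => (D n).goal) (k := fun n => k n + 1)
    (fun m n hmn => Nat.succ_le_succ (hk hmn)) fun n i hi => (h n).goal i (Nat.le_of_lt_succ hi)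
  obtain ⟨pos, hpos⟩ := exists_limit_seq (fun n => (D n).pos) hk fun n => (h n).pos
  obtain ⟨clause, hclause⟩ := exists_limit_seq (fun n => (D n).clause) hk fun n => (h n).clause
  obtain ⟨mgu, hmgu⟩ := exists_limit_seq (fun n => (D n).mgu) hk fun n => (h n).mgu
  have hlt : ∀ {i : ℕ}, (i : ℕ∞) < ⨆ n, (k n : ℕ∞) → ∃ n, i < k n := fun hi => by
    obtain ⟨n, hn⟩ := lt_iSup_iff.1 hi
    exact ⟨n, by exact_mod_cast hn⟩
  have hlen' : ∀ {n i : ℕ}, i < k n → (i : ℕ∞) < (D n).length := fun {n i} hi => by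
    rw [hlen]; exact_mod_cast hi
  refine ⟨{
    length := ⨆ n, (k n : ℕ∞)
    goal := goal
    pos := pos
    clause := clause
    mgu := mgu
    goal_zero := by rw [hgoal 0 0 (Nat.succ_pos _), (D 0).goal_zero]
    variant := ?_
    apart := ?_
    step := ?_ }, fun n => ⟨le_iSup (fun n => (k n : ℕ∞)) n,
      fun i hi => hgoal n i (Nat.lt_succ_of_le hi), hpos n, hclause n, hmgu n⟩⟩
  · intro i hi
    obtain ⟨n, hn⟩ := hlt hi
    rw [hclause n i hn]
    exact (D n).variant i (hlen' hn)
  · intro i hi x hx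
    obtain ⟨n, hn⟩ := hlt hi
    rw [hclause n i hn] at hx
    obtain ⟨h1, h2⟩ := (D n).apart i (hlen' hn) x hx
    refine ⟨fun j hj => ?_, fun j hj => ?_⟩
    · rw [hgoal n j (by omega)]
      exact h1 j hj
    · rw [hclause n j (by omega), hmgu n j (by omega)]
      exact h2 j hj
  · intro i hi
    obtain ⟨n, hn⟩ := hlt hi
    rw [hgoal n i (by omega), hgoal n (i + 1) (by omega), hpos n i hn, hclause n i hn,
      hmgu n i hn]
    exact (D n).step i (hlen' hn)

end Derivation

/-! ### Completeness -/

section Completeness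

variable [Countable (Σ l, L.Functions l)] {P : Program L} {G : Atom L ℕ}

open Classical in
theorem isResolutionTree_of_isDerivationSubtree {n : ℕ} {A : Atom L (Fin n)}
    {T : Set (Node (Atom L (Fin n)))} (h : (P.coalgebra.bar n A).IsDerivationSubtree T) :
    IsResolutionTree P A.toVar (Node.map Atom.toVar '' T) where
  root_mem a := by
    constructor
    · rintro ⟨(⟨b⟩ | _) | _, hy, e⟩ <;>
        simp only [Node.map, AndNode.map, Node.and.injEq, AndNode.root.injEq, reduceCtorEq] at e
      rw [← e, ((P.coalgebra.bar n A).root_mem b).1 (h.1.1 hy)]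
      rfl
    · rintro rfl
      exact ⟨_, h.1.2.1, rfl⟩
  parent_mem := by
    rintro _ ⟨y, hy, rfl⟩ z hz
    rw [Node.parent_map, Option.map_eq_some_iff] at hz
    obtain ⟨w, hw, rfl⟩ := hz
    exact ⟨w, h.1.2.2 y hy w hw, rfl⟩
  child_mem := by
    rintro x s ⟨_ | ⟨x, t⟩, hy, e⟩ a ha <;>
      simp only [Node.map, Node.or.injEq, reduceCtorEq] at e
    obtain ⟨rfl, rfl⟩ := e
    obtain ⟨b, hb, rfl⟩ := Finset.mem_image.1 ha
    exact ⟨_, h.2.2 x t hy _ (((P.coalgebra.bar n A).child_mem x t b).2 ⟨h.1.1 hy, hb⟩) rfl, rfl⟩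
  mem_of_child := by
    rintro x s a ⟨(_ | ⟨x, t, b⟩) | _, hy, e⟩ <;>
      simp only [Node.map, AndNode.map, Node.and.injEq, AndNode.child.injEq, reduceCtorEq] at e
    obtain ⟨rfl, rfl, rfl⟩ := e
    exact Finset.mem_image_of_mem _ (((P.coalgebra.bar n A).child_mem x t b).1 (h.1.1 hy)).2
  instance_of_or := by
    rintro x s ⟨_ | ⟨x, t⟩, hy, e⟩ <;>
      simp only [Node.map, Node.or.injEq, reduceCtorEq] at e
    obtain ⟨rfl, rfl⟩ := e
    have hu : UnfoldMem (P.coalgebra.app n) A (Node.or x t) := h.1.1 hy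
    cases hu with
    | or _ _ _ ht =>
      obtain ⟨C, hC, τ, h1, h2⟩ := ht
      exact ⟨C, hC, τ, by rw [h1, AndNode.label_map], h2.symm⟩

/-- The uniqueness of or-children in a derivation subtree survives the passage to atoms in all
variables, as this passage is injective on nodes. -/
theorem eq_of_or_mem_of_isDerivationSubtree {n : ℕ} {A : Atom L (Fin n)}
    {T : Set (Node (Atom L (Fin n)))} (h : (P.coalgebra.bar n A).IsDerivationSubtree T)
    (x : AndNode (Atom L ℕ)) (s t : Finset (Atom L ℕ))
    (hs : Node.or x s ∈ Node.map Atom.toVar '' T) (ht : Node.or x t ∈ Node.map Atom.toVar '' T) :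
    s = t := by
  obtain ⟨_ | ⟨y, s'⟩, hy, e⟩ := hs <;> simp only [Node.map, Node.or.injEq, reduceCtorEq] at e
  obtain ⟨_ | ⟨z, t'⟩, hz, e'⟩ := ht <;> simp only [Node.map, Node.or.injEq, reduceCtorEq] at e'
  obtain rfl := AndNode.map_injective (Atom.toVar_injective n) (e.1.trans e'.1.symm)
  have := h.2.1 y (h.1.2.2 _ hy _ rfl) _ hy _ hz rfl rfl
  rw [← e.2, ← e'.2, (Node.or.inj this).2]

/-- Dependent choice for a predicate that varies with the index. -/
theorem exists_seq_of_forall_exists {α : Type*} {Q : ℕ → α → Prop} {R : α → α → Prop}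
    (h0 : ∃ a, Q 0 a) (h : ∀ n a, Q n a → ∃ b, Q (n + 1) b ∧ R a b) :
    ∃ f : ℕ → α, (∀ n, Q n (f n)) ∧ ∀ n, R (f n) (f (n + 1)) := by
  obtain ⟨a, ha⟩ := h0
  choose g hg using h
  let f : ∀ n, {a // Q n a} :=
    fun n => Nat.rec ⟨a, ha⟩ (fun n b => ⟨g n b.1 b.2, (hg n b.1 b.2).1⟩) n
  exact ⟨fun n => (f n).1, fun n => (f n).2, fun n => (hg n (f n).1 (f n).2).2⟩

theorem Derivation.completeness (θ : ℕ → Subst L) (m : ℕ → ℕ) (A : ∀ n, Atom L (Fin (m n)))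
    (T : ∀ n, Set (Node (Atom L (Fin (m n)))))
    (hA : ∀ n, (A n).toVar = G.subst (Subst.compSeq θ (n + 1)))
    (hT : ∀ n, (T n).Finite ∧ (P.coalgebra.bar (m n) (A n)).IsDerivationSubtree (T n))
    (hsub : ∀ n, Node.map (fun B => B.toVar.subst (θ (n + 1))) '' T n ⊆
      Node.map Atom.toVar '' T (n + 1)) :
    ∃ (D : Derivation P G) (k : ℕ → ℕ), Monotone k ∧
      ∀ n, (k n : ℕ∞) ≤ D.length ∧ ∃ σ : Subst L,
        Node.map (fun B => B.subst σ) '' D.tree (k n) = Node.map Atom.toVar '' T n := by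
  have lift := fun n => Derivation.exists_lift (G := G)
    (isResolutionTree_of_isDerivationSubtree (hT n).2)
    (eq_of_or_mem_of_isDerivationSubtree (hT n).2) ((hT n).1.image _)
  obtain ⟨f, hf, hR⟩ := exists_seq_of_forall_exists (α := Derivation P G × ℕ × Subst L)
    (Q := fun n a => a.1.length = a.2.1 ∧ a.1.FinitelySupported a.2.1 ∧
      Node.map (fun B => B.subst a.2.2) '' a.1.tree a.2.1 = Node.map Atom.toVar '' T n)
    (R := fun a b => a.2.1 ≤ b.2.1 ∧ Agree a.1 b.1 a.2.1)
    (by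
      obtain ⟨E, l, γ, -, -, h⟩ := lift 0 (Derivation.nil P G) 0 (Subst.compSeq θ 1) rfl
        (fun j hj => absurd hj (Nat.not_lt_zero j)) (by
          rintro _ ⟨_, rfl, rfl⟩
          refine ⟨_, (hT 0).2.1.2.1, ?_⟩
          simp only [Node.map, AndNode.map]
          rw [← hA 0]
          rfl)
      exact ⟨⟨E, l, γ⟩, h⟩)
    (by
      rintro n ⟨D, k, σ⟩ ⟨h1, h2, h3⟩
      obtain ⟨E, l, γ, hl, hDE, h⟩ := lift (n + 1) D k (σ.comp (θ (n + 1))) h1 h2 (by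
        rw [← Node.image_map_subst_comp, h3, Set.image_image]
        simpa only [Node.map_map] using hsub n)
      exact ⟨⟨E, l, γ⟩, h, hl, hDE⟩)
  have hk : Monotone fun n => (f n).2.1 := monotone_nat_of_le_succ fun n => (hR n).1
  obtain ⟨E, hE⟩ := Derivation.exists_limit (fun n => (f n).1) hk (fun n => (hf n).1)
    fun n => (hR n).2
  refine ⟨E, _, hk, fun n => ⟨(hE n).1, (f n).2.2, ?_⟩⟩
  rw [(hE n).2.tree_eq le_rfl]
  exact (hf n).2.2

end Completeness

end LogicProg

theorem mainTheorem9 {L : FirstOrder.Language.{u, v}} [Countable (Σ l, L.Functions l)]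
    (P : LogicProg.Program L) (G : LogicProg.Atom L ℕ) :
    -- Soundness
    (∀ (D : LogicProg.Derivation P G) (k : ℕ), (k : ℕ∞) ≤ D.length →
      ∃ (n : ℕ) (A : LogicProg.Atom L (Fin n)), A.toVar = G.subst (D.answer k) ∧
        ∃ S : Set (LogicProg.Node (LogicProg.Atom L (Fin n))),
          LogicProg.Node.map LogicProg.Atom.toVar '' S = D.tree k ∧
          S.Finite ∧ (P.coalgebra.bar n A).IsSubtree S ∧
          (∃ T, LogicProg.IsPruning S T) ∧
          ∀ T, LogicProg.IsPruning S T → (P.coalgebra.bar n A).IsDerivationSubtree T) ∧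
    -- Completeness
    (∀ (θ : ℕ → LogicProg.Subst L) (m : ℕ → ℕ) (A : ∀ n, LogicProg.Atom L (Fin (m n)))
      (T : ∀ n, Set (LogicProg.Node (LogicProg.Atom L (Fin (m n))))),
      (∀ n, (A n).toVar = G.subst (LogicProg.Subst.compSeq θ (n + 1))) →
      (∀ n, (T n).Finite ∧ (P.coalgebra.bar (m n) (A n)).IsDerivationSubtree (T n)) →
      (∀ n, LogicProg.Node.map (fun B => B.toVar.subst (θ (n + 1))) '' T n ⊆
        LogicProg.Node.map LogicProg.Atom.toVar '' T (n + 1)) →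
      ∃ (D : LogicProg.Derivation P G) (k : ℕ → ℕ), Monotone k ∧
        ∀ n, (k n : ℕ∞) ≤ D.length ∧ ∃ σ : LogicProg.Subst L,
          LogicProg.Node.map (fun B => B.subst σ) '' D.tree (k n) =
            LogicProg.Node.map LogicProg.Atom.toVar '' T n) :=
  ⟨fun D k hk => D.soundness k hk, fun θ m A T hA hT hsub =>
    LogicProg.Derivation.completeness θ m A T hA hT hsub⟩
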